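/- All graphs are finite, without loops or parallel edges. For a graph $G$ and $p\in[1,\infty]$, let $f_p(G)$ be the least integer $k\ge 0$ such that for all $m$ and all vectors $(r_v)_{v\in V(G)}$ in $\mathbb{R}^m$ there exist vectors $(q_v)_{v\in V(G)}$ in $\mathbb{R}^k$ with $\|r_v-r_w\|_p=\|q_v-q_w\|_p$ for all edges $vw\in E(G)$ (with $f_p(G)=\infty$ if there were no such $k$). A graph $H$ is a minor of $G$ if $H$ can be obtained from a subgraph of $G$ by contracting edges, loops and parallel edges being suppressed. A graph $G$ is an excluded minor for $f_p\le k$ if $f_p(G)>k$ and $f_p(H)\le k$ for every minor $H$ of $G$ that is not isomorphic to $G$. Let $W_4$ be the wheel on five vertices (a $4$-cycle and one further vertex adjacent to all its vertices), and let $K_4+_eK_4$ be the graph on six vertices obtained by gluing two copies of $K_4$ along an edge $e$ and then deleting $e$. (i) A graph is an excluded minor for $f_1\le 2$ if and only if it is isomorphic to $W_4$ or to $K_4+_eK_4$. (ii) For every graph $G$, $f_1(G)\le 2$ if and only if $f_\infty(G)\le 2$. -/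

import Mathlib

open scoped ENNReal

universe u v

/-- The graph `G` can be realized in `ℓ_p^k`: for all `m` and all vectors `(r_v)` in `ℝ^m` there are
vectors `(q_v)` in `ℝ^k` with the same `ℓ_p`-distances along all the edges of `G`.
(`PiLp p (fun _ : Fin m => ℝ)` is `ℝ^m` with the `ℓ_p`-norm.) -/
def RealizableIn (p : ℝ≥0∞) [Fact (1 ≤ p)] {V : Type u} (G : SimpleGraph V) (k : ℕ) : Prop :=
  ∀ (m : ℕ) (r : V → PiLp p (fun _ : Fin m => ℝ)),
    ∃ q : V → PiLp p (fun _ : Fin k => ℝ),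
      ∀ v w : V, G.Adj v w → ‖r v - r w‖ = ‖q v - q w‖

/-- The parameter `f_p(G)`: the least `k` such that `G` can be realized in `ℓ_p^k`
(with the value `⊤` if there were no such `k`). -/
noncomputable def fParam (p : ℝ≥0∞) [Fact (1 ≤ p)] {V : Type u} (G : SimpleGraph V) : ℕ∞ :=
  ⨅ (k : ℕ) (_ : RealizableIn p G k), (k : ℕ∞)

/-- `H` is obtained from `K` by contracting edges (and suppressing loops and parallel edges):
the vertices of `H` correspond to the parts of a partition of the vertex set of `K` into nonempty
connected parts (the fibres of `φ`), and distinct vertices of `H` are adjacent exactly when some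
edge of `K` joins the corresponding parts. `SimpleGraph.Connected` includes nonemptiness, so that
`φ` is onto. -/
def IsContraction {W : Type u} {V : Type v} (H : SimpleGraph W) (K : SimpleGraph V) : Prop :=
  ∃ φ : V → W,
    (∀ a : W, (K.induce {x | φ x = a}).Connected) ∧
    ∀ a b : W, H.Adj a b ↔ a ≠ b ∧ ∃ x y : V, φ x = a ∧ φ y = b ∧ K.Adj x y

/-- `H` is a minor of `G`: it is obtained from a subgraph of `G` by contracting edges. -/
def IsMinor {W : Type u} {V : Type v} (H : SimpleGraph W) (G : SimpleGraph V) : Prop :=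
  ∃ S : G.Subgraph, IsContraction H S.coe

/-- `G` is an excluded minor for `f_p ≤ k`: it is minor-minimal among the finite graphs with
`f_p > k`. A proper minor of a finite graph is a minor that is not isomorphic to it. -/
def IsExcludedMinor (p : ℝ≥0∞) [Fact (1 ≤ p)] (k : ℕ) {V : Type u} (G : SimpleGraph V) : Prop :=
  (k : ℕ∞) < fParam p G ∧
    ∀ (W : Type u) [Finite W] (H : SimpleGraph W),
      IsMinor H G → ¬ Nonempty (H ≃g G) → fParam p H ≤ k

/-- The wheel `W₄` on five vertices: the rim is the cycle `0, 1, 2, 3`, the hub is `4`. -/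
def wheelFour : SimpleGraph (Fin 5) :=
  SimpleGraph.fromEdgeSet
    {s(0, 1), s(1, 2), s(2, 3), s(3, 0), s(4, 0), s(4, 1), s(4, 2), s(4, 3)}

/-- The graph `K₄ +ₑ K₄`: complete graphs on `{0, 1, 2, 3}` and on `{0, 1, 4, 5}`, glued along the
edge `e = 01`, which is then deleted. -/
def kFourPlusKFour : SimpleGraph (Fin 6) :=
  SimpleGraph.fromEdgeSet
    {s(0, 2), s(0, 3), s(1, 2), s(1, 3), s(2, 3),
     s(0, 4), s(0, 5), s(1, 4), s(1, 5), s(4, 5)}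

/-!
Both parts rest on the equivalence, for a finite graph `G`, of three properties: realizability in
`ℓ_1^2`, realizability in `ℓ_∞^2`, and the absence of the minors `W₄` and `K₄ +ₑ K₄`.

Realizability passes to minors (`RealizableIn.of_hasMinorModel`), and explicit points of `ℓ_1^4` and
`ℓ_1^3` whose distances along the edges of `W₄` and `K₄ +ₑ K₄` cannot be attained in the plane show
that neither graph is realizable in `ℓ_1^2` (`not_realizableIn_wheelFour`,
`not_realizableIn_kFourPlusKFour`). Since `ℓ_1^2` and `ℓ_∞^2` are isometric and every finite metric
space embeds into some `ℓ_∞^m`, realizability in `ℓ_∞^2` implies realizability in `ℓ_1^2`.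

It remains to realize every graph without the two minors in the plane with the supremum norm
(`planeRealizable_of_not_hasMinorModel`), by induction on the number of vertices. Four points always
embed isometrically; graphs with a cut vertex are glued from smaller ones; a vertex with just two
neighbours is replaced by an edge between them and put back where two spheres meet. What is left is
a structure theorem, `TwoConn.hasMinorModel_wheelFour_or_kFourPlusKFour`: a two-connected graph with
minimum degree at least three and at least five vertices has one of the two minors. This is again an
induction, down to the graphs on five vertices, which contain `W₄`. If no two vertices separate the
graph, then it has an edge whose contraction keeps the minimum degree, since otherwise a triangle of
vertices of degree three would have only two outside neighbours. If `x`, `y` separate `A` from `B`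
with `A` as small as possible, then the graph induced on `A ∪ {x, y}` with the edge `xy` added is a
smaller graph with the same properties, unless `A` consists of two vertices; in that case either
the same holds for `B ∪ {x, y}`, or an edge from `x` or `y` to `B` can be contracted, or `B`
consists of two vertices as well, and the graph contains `K₄ +ₑ K₄`.
-/

/-! ### Minor models -/

/-- `H` has a minor model in `G`: a partial map `f` from the vertices of `G` to those of `H` whose
fibres (the branch sets) are connected, in particular nonempty, such that every edge of `H` is
represented by an edge of `G` between the corresponding branch sets. In contrast to `IsMinor`, no
subgraph is singled out, so that such models are easy to write down and to compose. -/
def HasMinorModel {W : Type*} {V : Type*} (H : SimpleGraph W) (G : SimpleGraph V) : Prop :=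
  ∃ f : V → Option W,
    (∀ a, (G.induce {x | f x = some a}).Connected) ∧
    ∀ a b, H.Adj a b → ∃ x y, f x = some a ∧ f y = some b ∧ G.Adj x y

section Models

variable {U W V : Type*}

lemma IsMinor.hasMinorModel {W : Type u} {V : Type v} {H : SimpleGraph W} {G : SimpleGraph V}
    (h : IsMinor H G) : HasMinorModel H G := by
  classical
  obtain ⟨S, φ, hc, ha⟩ := h
  have key : ∀ x a, (if h : x ∈ S.verts then some (φ ⟨x, h⟩) else none) = some a ↔
      ∃ h : x ∈ S.verts, φ ⟨x, h⟩ = a := by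
    intro x a
    split_ifs with h <;> simp [h]
  refine ⟨fun x => if h : x ∈ S.verts then some (φ ⟨x, h⟩) else none, fun a => ?_, ?_⟩
  · let F : S.coe.induce {x | φ x = a} →g
        G.induce {x | (if h : x ∈ S.verts then some (φ ⟨x, h⟩) else none) = some a} :=
      { toFun := fun x => ⟨x.1.1, (key _ _).2 ⟨x.1.2, x.2⟩⟩
        map_rel' := fun {x y} hxy => S.adj_sub hxy }
    refine (hc a).map F ?_
    rintro ⟨x, hx⟩
    obtain ⟨h, h'⟩ := (key _ _).1 hx
    exact ⟨⟨⟨x, h⟩, h'⟩, rfl⟩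
  · intro a b hab
    obtain ⟨-, x, y, hx, hy, hxy⟩ := (ha a b).1 hab
    exact ⟨x, y, (key _ _).2 ⟨x.2, hx⟩, (key _ _).2 ⟨y.2, hy⟩, S.adj_sub hxy⟩

lemma HasMinorModel.isMinor {W : Type u} {V : Type v} {H : SimpleGraph W} {G : SimpleGraph V}
    (h : HasMinorModel H G) : IsMinor H G := by
  obtain ⟨f, hc, ha⟩ := h
  -- The subgraph keeps the edges inside the branch sets and those that represent edges of `H`.
  let S : G.Subgraph :=
    { verts := {x | ∃ a, f x = some a}
      Adj := fun x y => G.Adj x y ∧ ∃ a b, f x = some a ∧ f y = some b ∧ (a = b ∨ H.Adj a b)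
      adj_sub := fun h => h.1
      edge_vert := fun h => ⟨_, h.2.choose_spec.choose_spec.1⟩
      symm := ⟨fun x y => by
        rintro ⟨h, a, b, hx, hy, hab⟩
        exact ⟨h.symm, b, a, hy, hx, hab.imp Eq.symm SimpleGraph.Adj.symm⟩⟩ }
  choose φ hφ using fun x : S.verts => x.2
  refine ⟨S, φ, fun a => ?_, fun a b => ⟨fun hab => ?_, ?_⟩⟩
  · have hv : ∀ x, f x = some a → ∃ a, f x = some a := fun x hx => ⟨a, hx⟩
    let F : G.induce {x | f x = some a} →g S.coe.induce {x | φ x = a} :=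
      { toFun := fun x => ⟨⟨x.1, hv _ x.2⟩, Option.some_injective _
          ((hφ ⟨x.1, hv _ x.2⟩).symm.trans x.2)⟩
        map_rel' := fun {x y} hxy => ⟨hxy, a, a, x.2, y.2, Or.inl rfl⟩ }
    refine (hc a).map F ?_
    rintro ⟨x, hx⟩
    exact ⟨⟨x.1, (hφ x).trans (congrArg some hx)⟩, rfl⟩
  · obtain ⟨x, y, hx, hy, hxy⟩ := ha a b hab
    refine ⟨hab.ne, ⟨x, a, hx⟩, ⟨y, b, hy⟩, Option.some_injective _ ((hφ _).symm.trans hx),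
      Option.some_injective _ ((hφ _).symm.trans hy), hxy, a, b, hx, hy, Or.inr hab⟩
  · rintro ⟨hne, x, y, rfl, rfl, -, a, b, hx, hy, hab⟩
    have h1 := Option.some_injective _ ((hφ x).symm.trans hx)
    have h2 := Option.some_injective _ ((hφ y).symm.trans hy)
    subst h1 h2
    exact hab.resolve_left hne

lemma HasMinorModel.of_injective_hom {H : SimpleGraph W} {G : SimpleGraph V} (g : H →g G)
    (hg : Function.Injective g) : HasMinorModel H G := by
  classical
  have key : ∀ x a, (if h : ∃ a, g a = x then some h.choose else none) = some a ↔ g a = x := by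
    intro x a
    split_ifs with h
    · have := h.choose_spec
      constructor
      · intro h'
        rw [← Option.some_injective _ h', this]
      · intro h'
        rw [hg (h'.trans this.symm)]
    · simp only [false_iff]
      exact fun h' => h ⟨a, h'⟩
  refine ⟨fun x => if h : ∃ a, g a = x then some h.choose else none, fun a => ?_,
    fun a b hab => ⟨g a, g b, (key _ _).2 rfl, (key _ _).2 rfl, g.map_adj hab⟩⟩
  have : {x | (if h : ∃ a, g a = x then some h.choose else none) = some a} = {g a} := by
    ext x
    rw [Set.mem_ofPred_eq, key, Set.mem_singleton_iff, eq_comm]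
  rw [this]
  exact SimpleGraph.Connected.of_subsingleton

lemma HasMinorModel.of_iso {H : SimpleGraph W} {G : SimpleGraph V} (e : H ≃g G) :
    HasMinorModel H G :=
  .of_injective_hom e.toHom e.injective

lemma HasMinorModel.trans {K : SimpleGraph U} {H : SimpleGraph W} {G : SimpleGraph V}
    (h₁ : HasMinorModel K H) (h₂ : HasMinorModel H G) : HasMinorModel K G := by
  obtain ⟨g, hgc, hga⟩ := h₁
  obtain ⟨f, hfc, hfa⟩ := h₂
  have key : ∀ x a c, f x = some a → g a = some c → (f x).bind g = some c := by
    intro x a c h h'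
    rw [h, Option.bind_some, h']
  have key' : ∀ x c, (f x).bind g = some c → ∃ a, f x = some a ∧ g a = some c :=
    fun x c h => Option.bind_eq_some_iff.1 h
  refine ⟨fun x => (f x).bind g, fun c => ?_, fun a b hab => ?_⟩
  · -- Two vertices of the same branch set of `H` are joined inside it.
    have fib : ∀ a (ha : g a = some c) x y (hx : f x = some a) (hy : f y = some a),
        (G.induce {x | (f x).bind g = some c}).Reachable ⟨x, key _ _ _ hx ha⟩
          ⟨y, key _ _ _ hy ha⟩ := by
      intro a ha x y hx hy
      let F : G.induce {x | f x = some a} →g G.induce {x | (f x).bind g = some c} :=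
        { toFun := fun x => ⟨x.1, key _ _ _ x.2 ha⟩
          map_rel' := fun {x y} hxy => hxy }
      exact ((hfc a).preconnected ⟨x, hx⟩ ⟨y, hy⟩).map F
    have walk : ∀ a b : {a | g a = some c}, (H.induce {a | g a = some c}).Walk a b →
        ∀ x y (hx : f x = some a.1) (hy : f y = some b.1),
        (G.induce {x | (f x).bind g = some c}).Reachable ⟨x, key _ _ _ hx a.2⟩
          ⟨y, key _ _ _ hy b.2⟩ := by
      intro a b p
      induction p with
      | @nil a => exact fun x y hx hy => fib _ a.2 x y hx hy
      | @cons a b c' hab p ih =>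
        intro x y hx hy
        obtain ⟨x', y', hx', hy', hxy⟩ := hfa _ _ hab
        refine (fib _ a.2 x x' hx hx').trans (.trans ?_ (ih y' y hy' hy))
        exact SimpleGraph.Adj.reachable (G := G.induce {x | (f x).bind g = some c}) hxy
    obtain ⟨⟨a, ha⟩⟩ := (hgc c).nonempty
    obtain ⟨⟨x, hx⟩⟩ := (hfc a).nonempty
    rw [SimpleGraph.connected_iff]
    refine ⟨?_, ⟨⟨x, key _ _ _ hx ha⟩⟩⟩
    rintro ⟨y, hy⟩ ⟨z, hz⟩
    obtain ⟨a, hya, hac⟩ := key' _ _ hy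
    obtain ⟨b, hzb, hbc⟩ := key' _ _ hz
    obtain ⟨p⟩ := (hgc c).preconnected ⟨a, hac⟩ ⟨b, hbc⟩
    exact walk _ _ p y z hya hzb
  · obtain ⟨a', b', ha', hb', hab'⟩ := hga a b hab
    obtain ⟨x, y, hx, hy, hxy⟩ := hfa a' b' hab'
    exact ⟨x, y, key _ _ _ hx ha', key _ _ _ hy hb', hxy⟩

/-- Realizability passes to minors: pull the vectors back along the model; the vectors realizing
them are constant on each branch set, as all the distances inside it vanish. -/
lemma RealizableIn.of_hasMinorModel {p : ℝ≥0∞} [Fact (1 ≤ p)] {k : ℕ} {H : SimpleGraph W}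
    {G : SimpleGraph V} (hG : RealizableIn p G k) (h : HasMinorModel H G) :
    RealizableIn p H k := by
  obtain ⟨f, hc, ha⟩ := h
  intro m r
  obtain ⟨q, hq⟩ := hG m (fun v => (f v).elim 0 r)
  have const : ∀ a x, f x = some a → ∀ y, f y = some a → q x = q y := by
    intro a x hx y hy
    obtain ⟨w⟩ := (hc a).preconnected ⟨x, hx⟩ ⟨y, hy⟩
    have : ∀ s t : {x | f x = some a}, (G.induce {x | f x = some a}).Walk s t →
        q s = q t := by
      intro s t w
      induction w with
      | nil => rfl
      | @cons s t _ hst _ ih =>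
        rw [← ih]
        have := hq s.1 t.1 hst
        rw [show f s.1 = some a from s.2, show f t.1 = some a from t.2, sub_self, norm_zero] at this
        exact sub_eq_zero.1 (norm_eq_zero.1 this.symm)
    exact this _ _ w
  refine ⟨fun a => q (hc a).nonempty.some.1, fun a b hab => ?_⟩
  obtain ⟨x, y, hx, hy, hxy⟩ := ha a b hab
  have := hq x y hxy
  rw [hx, hy] at this
  dsimp only
  rw [const a _ (hc a).nonempty.some.2 x hx, const b _ (hc b).nonempty.some.2 y hy]
  exact this

/-- A model together with a choice of a vertex in each branch set. -/
lemma HasMinorModel.exists_section {H : SimpleGraph W} {G : SimpleGraph V}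
    (h : HasMinorModel H G) :
    ∃ f : V → Option W, ∃ g : W → V, (∀ a, f (g a) = some a) ∧
    (∀ a, (G.induce {x | f x = some a}).Connected) ∧
    ∀ a b, H.Adj a b → ∃ x y, f x = some a ∧ f y = some b ∧ G.Adj x y := by
  obtain ⟨f, hc, ha⟩ := h
  exact ⟨f, fun a => (hc a).nonempty.some.1, fun a => (hc a).nonempty.some.2, hc, ha⟩

lemma HasMinorModel.card_le [Finite V] {H : SimpleGraph W} {G : SimpleGraph V}
    (h : HasMinorModel H G) : Nat.card W ≤ Nat.card V := by
  obtain ⟨f, g, hg, -⟩ := h.exists_section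
  refine Nat.card_le_card_of_injective g fun a b hab => Option.some_injective _ ?_
  rw [← hg a, ← hg b, hab]

/-- A model in a graph that is not larger has singletons as branch sets. -/
lemma HasMinorModel.exists_hom [Finite V] {H : SimpleGraph W} {G : SimpleGraph V}
    (h : HasMinorModel H G) (hc : Nat.card V ≤ Nat.card W) :
    ∃ e : H →g G, Function.Bijective e := by
  obtain ⟨f, g, hg, -, ha⟩ := h.exists_section
  have hinj : Function.Injective g := fun a b hab => Option.some_injective _ (by
    rw [← hg a, ← hg b, hab])
  have : Finite W := Finite.of_injective g hinj
  have hbij : Function.Bijective g :=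
    (Nat.bijective_iff_injective_and_card g).2 ⟨hinj, le_antisymm h.card_le hc⟩
  have hf : ∀ x a, f x = some a → x = g a := by
    intro x a hx
    obtain ⟨b, rfl⟩ := hbij.2 x
    rw [Option.some_injective _ ((hg b).symm.trans hx)]
  refine ⟨⟨g, fun {a b} hab => ?_⟩, hbij⟩
  obtain ⟨x, y, hx, hy, hxy⟩ := ha a b hab
  rwa [hf x a hx, hf y b hy] at hxy

/-- The minor relation is antisymmetric on finite graphs, up to isomorphism. -/
lemma HasMinorModel.antisymm [Finite V] [Finite W] {H : SimpleGraph W} {G : SimpleGraph V}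
    (h₁ : HasMinorModel H G) (h₂ : HasMinorModel G H) : Nonempty (H ≃g G) := by
  classical
  have := Fintype.ofFinite V
  have := Fintype.ofFinite W
  obtain ⟨e, he⟩ := h₁.exists_hom h₂.card_le
  obtain ⟨e', he'⟩ := h₂.exists_hom h₁.card_le
  have hinj := SimpleGraph.Hom.mapEdgeSet.injective e he.injective
  have hbij : Function.Bijective e.mapEdgeSet :=
    (Nat.bijective_iff_injective_and_card _).2 ⟨hinj, le_antisymm
      (Nat.card_le_card_of_injective _ hinj) (Nat.card_le_card_of_injective _
        (SimpleGraph.Hom.mapEdgeSet.injective e' he'.injective))⟩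
  refine ⟨⟨Equiv.ofBijective e he, fun {a b} => ⟨fun hab => ?_, fun hab => e.map_adj hab⟩⟩⟩
  obtain ⟨⟨z, hz⟩, hz'⟩ := hbij.2 ⟨s(e a, e b), hab⟩
  have h : Sym2.map e z = Sym2.map e s(a, b) := congrArg Subtype.val hz'
  rw [Sym2.map.injective he.injective h] at hz
  exact hz

end Models

/-! ### Two-connected graphs, two-separations and contractions -/

section Connectivity

variable {V : Type*}

/-- A nonempty set of vertices all of whose outside neighbours equal `z` exhausts the vertices other
than `z`. On at least three vertices this says that `G` is connected without cut vertices; every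
graph on at most two vertices qualifies. -/
def TwoConn (G : SimpleGraph V) : Prop :=
  ∀ (A : Set V) (z : V), A.Nonempty → z ∉ A → (∀ a ∈ A, ∀ b, G.Adj a b → b ∈ A ∨ b = z) →
    ∀ w, w ∈ A ∨ w = z

/-- Every vertex of `G` has at least three neighbours, stated without cardinalities: two vertices
never exhaust a neighbourhood. -/
def MinDegThree (G : SimpleGraph V) : Prop :=
  ∀ v a b, ∃ c, G.Adj v c ∧ c ≠ a ∧ c ≠ b

/-- The vertices of `G` are partitioned into nonempty sets `A`, `B` and the pair `x`, `y`, and no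
edge joins `A` to `B`. -/
structure IsTwoSeparation (G : SimpleGraph V) (A B : Set V) (x y : V) : Prop where
  left_nonempty : A.Nonempty
  right_nonempty : B.Nonempty
  disjoint : ∀ v ∈ A, v ∉ B
  left_notMem_left : x ∉ A
  right_notMem_left : y ∉ A
  left_notMem_right : x ∉ B
  right_notMem_right : y ∉ B
  cover : ∀ v, v ∈ A ∨ v ∈ B ∨ v = x ∨ v = y
  not_adj : ∀ a ∈ A, ∀ b ∈ B, ¬ G.Adj a b

/-- The subgraph of `G` induced on `s` with the edge `xy` added. -/
def torso (G : SimpleGraph V) (s : Set V) (x y : V) : SimpleGraph s where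
  Adj a b := a ≠ b ∧ (G.Adj a b ∨ (a.1 = x ∧ b.1 = y) ∨ (a.1 = y ∧ b.1 = x))
  symm := ⟨fun a b h => ⟨h.1.symm, h.2.imp (fun h => h.symm) (fun h => by tauto)⟩⟩
  loopless := ⟨fun a h => h.1 rfl⟩

/-- The graph obtained from `G` by contracting `v` into `u`. -/
def contractInto (G : SimpleGraph V) (u v : V) : SimpleGraph {w // w ≠ v} where
  Adj a b := a ≠ b ∧ (G.Adj a b ∨ (a.1 = u ∧ G.Adj v b) ∨ (b.1 = u ∧ G.Adj v a))
  symm := ⟨fun a b h => ⟨h.1.symm, h.2.imp (fun h => h.symm) (fun h => by tauto)⟩⟩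
  loopless := ⟨fun a h => h.1 rfl⟩

variable {G : SimpleGraph V} {A B : Set V} {x y : V}

lemma IsTwoSeparation.symm (h : IsTwoSeparation G A B x y) : IsTwoSeparation G B A x y :=
  ⟨h.2, h.1, fun v hv hv' => h.3 v hv' hv, h.6, h.7, h.4, h.5, fun v => by have := h.8 v; tauto,
    fun a ha b hb hab => h.9 b hb a ha hab.symm⟩

lemma IsTwoSeparation.swap (h : IsTwoSeparation G A B x y) : IsTwoSeparation G A B y x :=
  ⟨h.1, h.2, h.3, h.5, h.4, h.7, h.6, fun v => by have := h.8 v; tauto, h.9⟩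

lemma hasMinorModel_contractInto {u v : V} (huv : G.Adj u v) :
    HasMinorModel (contractInto G u v) G := by
  classical
  obtain ⟨f, key⟩ : ∃ f : V → Option {w // w ≠ v},
      ∀ w a, f w = some a ↔ w = a.1 ∨ w = v ∧ a.1 = u := by
    refine ⟨fun w => if h : w = v then some ⟨u, huv.ne⟩ else some ⟨w, h⟩, ?_⟩
    rintro w ⟨a, ha⟩
    dsimp only
    split_ifs with h
    · subst h
      simp [ha.symm, eq_comm]
    · simp [h]
  refine ⟨f, fun a => ?_, ?_⟩
  · by_cases ha : a.1 = u
    · have : {w | f w = some a} = {u, v} := by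
        ext w
        simp [key, ha]
      rw [this]
      exact SimpleGraph.induce_pair_connected_of_adj huv
    · have : {w | f w = some a} = {a.1} := by
        ext w
        simp [key, ha]
      rw [this]
      exact SimpleGraph.Connected.of_subsingleton
  · rintro a b ⟨-, hab | ⟨ha, hb⟩ | ⟨hb, ha⟩⟩
    · exact ⟨a, b, (key _ _).2 (.inl rfl), (key _ _).2 (.inl rfl), hab⟩
    · exact ⟨v, b, (key _ _).2 (.inr ⟨rfl, ha⟩), (key _ _).2 (.inl rfl), hb⟩
    · exact ⟨a, v, (key _ _).2 (.inl rfl), (key _ _).2 (.inr ⟨rfl, hb⟩), ha.symm⟩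

lemma hasMinorModel_torso {s D : Set V} (hx : x ∈ s) (hxD : x ∈ D)
    (hD : (G.induce D).Connected) (hDs : ∀ v ∈ D, v ∈ s → v = x) (hy : ∃ d ∈ D, G.Adj d y) :
    HasMinorModel (torso G s x y) G := by
  classical
  obtain ⟨f, key⟩ : ∃ f : V → Option s,
      ∀ w a, f w = some a ↔ w = a.1 ∨ w ∈ D ∧ a.1 = x := by
    refine ⟨fun w => if h : w ∈ s then some ⟨w, h⟩ else if w ∈ D then some ⟨x, hx⟩ else none, ?_⟩
    rintro w ⟨a, ha⟩
    dsimp only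
    split_ifs with h h'
    · simp only [Option.some.injEq, Subtype.mk.injEq]
      refine ⟨.inl, ?_⟩
      rintro (h' | ⟨h', rfl⟩)
      · exact h'
      · exact hDs _ h' h
    · simp only [Option.some.injEq, Subtype.mk.injEq, h', true_and]
      refine ⟨fun h => .inr h.symm, ?_⟩
      rintro (rfl | h')
      · exact absurd ha h
      · exact h'.symm
    · simp only [false_iff, h', false_and, or_false]
      rintro rfl
      exact h ha
  obtain ⟨d, hd, hdy⟩ := hy
  refine ⟨f, fun a => ?_, ?_⟩
  · by_cases ha : a.1 = x
    · have : {w | f w = some a} = D := by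
        ext w
        simp only [key, ha, and_true, Set.mem_ofPred_eq, or_iff_right_iff_imp]
        rintro rfl
        exact hxD
      rwa [this]
    · have : {w | f w = some a} = {a.1} := by
        ext w
        simp [key, ha]
      rw [this]
      exact SimpleGraph.Connected.of_subsingleton
  · rintro a b ⟨-, hab | ⟨ha, hb⟩ | ⟨ha, hb⟩⟩
    · exact ⟨a, b, (key _ _).2 (.inl rfl), (key _ _).2 (.inl rfl), hab⟩
    · exact ⟨d, b, (key _ _).2 (.inr ⟨hd, ha⟩), (key _ _).2 (.inl rfl), hb ▸ hdy⟩
    · exact ⟨a, d, (key _ _).2 (.inl rfl), (key _ _).2 (.inr ⟨hd, hb⟩), ha ▸ hdy.symm⟩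

/-- The vertices reachable from `x` through `B`. -/
lemma exists_connected_closed (G : SimpleGraph V) (B : Set V) (x : V) :
    ∃ D ⊆ insert x B, x ∈ D ∧ (G.induce D).Connected ∧
      ∀ d ∈ D, ∀ w ∈ B, G.Adj d w → w ∈ D := by
  refine ⟨{w | ∃ p : G.Walk x w, ∀ t ∈ p.support, t ∈ insert x B}, ?_, ?_, ?_, ?_⟩
  · rintro w ⟨p, hp⟩
    exact hp _ p.end_mem_support
  · exact ⟨.nil, by simp⟩
  · refine SimpleGraph.induce_connected_of_patches x ⟨.nil, by simp⟩ ?_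
    rintro w ⟨p, hp⟩
    refine ⟨{t | t ∈ p.support}, fun t ht => ?_, p.start_mem_support, p.end_mem_support,
      p.connected_induce_support.preconnected _ _⟩
    classical
    exact ⟨p.takeUntil t ht, fun r hr => hp _ (p.support_takeUntil_subset_support ht hr)⟩
  · rintro d ⟨p, hp⟩ w hw hdw
    refine ⟨p.concat hdw, fun t ht => ?_⟩
    rw [SimpleGraph.Walk.support_concat, List.mem_append,
      List.mem_singleton] at ht
    rcases ht with ht | rfl
    · exact hp t ht
    · exact Or.inr hw

lemma IsTwoSeparation.ne (h : IsTwoSeparation G A B x y) (hG : TwoConn G) : x ≠ y := by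
  rintro rfl
  obtain ⟨b, hb⟩ := h.right_nonempty
  have := hG A x h.left_nonempty h.left_notMem_left (fun a ha b hab => by
    have := h.cover b; have := h.not_adj a ha b; tauto) b
  have := h.disjoint b
  rcases ‹b ∈ A ∨ b = x› with h1 | rfl
  · exact this h1 hb
  · exact h.left_notMem_right hb

/-- Both vertices of a two-separation of a `TwoConn` graph have neighbours on each side. -/
lemma IsTwoSeparation.exists_adj (h : IsTwoSeparation G A B x y) (hG : TwoConn G) :
    ∃ a ∈ A, G.Adj x a := by
  by_contra! hc
  have := hG A y h.left_nonempty h.right_notMem_left (fun a ha b hab => by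
    have := h.cover b; have := h.not_adj a ha b
    have : b ≠ x := fun hb => hc a ha (hb ▸ hab.symm)
    tauto) x
  exact this.elim h.left_notMem_left (h.ne hG)

lemma IsTwoSeparation.hasMinorModel_torso (h : IsTwoSeparation G A B x y) (hG : TwoConn G) :
    HasMinorModel (torso G Bᶜ x y) G := by
  obtain ⟨D, hDB, hxD, hD, hcl⟩ := exists_connected_closed G B x
  refine _root_.hasMinorModel_torso h.left_notMem_right hxD hD
    (fun v hv hv' => (hDB hv).resolve_right hv') ?_
  by_contra! hc
  -- Otherwise `x` alone separates the part of `D` in `B` from `y`.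
  obtain ⟨b, hb, hxb⟩ := h.symm.exists_adj hG
  have := hG (D \ {x}) x ⟨b, hcl x hxD b hb hxb, fun hbx => h.left_notMem_right (hbx ▸ hb)⟩
    (fun hx => hx.2 rfl) (fun a ha w haw => ?_) y
  · rcases this with h1 | h1
    · rcases hDB h1.1 with h2 | h2
      · exact h.ne hG h2.symm
      · exact h.right_notMem_right h2
    · exact h.ne hG h1.symm
  · by_cases hw : w = x
    · exact Or.inr hw
    · have ha' : a ∈ B := (hDB ha.1).resolve_left ha.2
      rcases h.cover w with hw' | hw' | hw' | rfl
      · exact absurd haw.symm (h.not_adj w hw' a ha')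
      · exact Or.inl ⟨hcl a ha.1 w hw' haw, hw⟩
      · exact absurd hw' hw
      · exact absurd haw (hc a ha.1)

lemma IsTwoSeparation.twoConn_torso (h : IsTwoSeparation G A B x y) (hG : TwoConn G) :
    TwoConn (torso G Bᶜ x y) := by
  intro S z hS hz hcl w
  have hxy := h.ne hG
  have hadj : ∀ a b : (Bᶜ : Set V), G.Adj a b → (torso G Bᶜ x y).Adj a b :=
    fun a b hab => ⟨fun e => hab.ne (congrArg Subtype.val e), Or.inl hab⟩
  have hfin : ∀ w : (Bᶜ : Set V), ∀ T : Set V, (∀ v (hv : v ∉ B), v ∈ T → ⟨v, hv⟩ ∈ S) →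
      w.1 ∈ T ∨ w.1 = z.1 → w ∈ S ∨ w = z := fun w T hT hw =>
    hw.imp (hT w.1 w.2) Subtype.ext
  by_cases hxyS : (⟨x, h.left_notMem_right⟩ : (Bᶜ : Set V)) ∈ S ∨
      (⟨y, h.right_notMem_right⟩ : (Bᶜ : Set V)) ∈ S
  · -- The set `S ∪ B` is closed in `G`, as `x` and `y` both lie in `S ∪ {z}`.
    have hx : (⟨x, h.left_notMem_right⟩ : (Bᶜ : Set V)) ∈ S ∨
        (⟨x, h.left_notMem_right⟩ : (Bᶜ : Set V)) = z := by
      rcases hxyS with h1 | h1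
      · exact Or.inl h1
      · exact hcl _ h1 _ ⟨fun e => hxy (congrArg Subtype.val e).symm, Or.inr (Or.inr ⟨rfl, rfl⟩)⟩
    have hy : (⟨y, h.right_notMem_right⟩ : (Bᶜ : Set V)) ∈ S ∨
        (⟨y, h.right_notMem_right⟩ : (Bᶜ : Set V)) = z := by
      rcases hxyS with h1 | h1
      · exact hcl _ h1 _ ⟨fun e => hxy (congrArg Subtype.val e), Or.inr (Or.inl ⟨rfl, rfl⟩)⟩
      · exact Or.inl h1
    refine hfin w (Subtype.val '' S ∪ B) (fun v hv hvT => ?_) (hG (Subtype.val '' S ∪ B) z ?_ ?_ ?_ w)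
    · rcases hvT with ⟨t, ht, rfl⟩ | h1
      · exact ht
      · exact absurd h1 hv
    · obtain ⟨s, hs⟩ := hS
      exact ⟨s, Or.inl ⟨s, hs, rfl⟩⟩
    · rintro (⟨t, ht, he⟩ | h1)
      · exact hz (Subtype.ext he ▸ ht)
      · exact z.2 h1
    · intro a ha b hab
      by_cases hb : b ∈ B
      · exact Or.inl (Or.inr hb)
      have : (⟨b, hb⟩ : (Bᶜ : Set V)) ∈ S ∨ (⟨b, hb⟩ : (Bᶜ : Set V)) = z := by
        rcases ha with ⟨t, ht, rfl⟩ | ha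
        · exact hcl t ht ⟨b, hb⟩ (hadj _ _ hab)
        · rcases h.cover b with h1 | h1 | rfl | rfl
          · exact absurd hab.symm (h.not_adj b h1 a ha)
          · exact absurd h1 hb
          · exact hx
          · exact hy
      rcases this with h1 | h1
      · exact Or.inl (Or.inl ⟨_, h1, rfl⟩)
      · exact Or.inr (congrArg Subtype.val h1)
  · -- The set `S` lies in `A`, so it has the same neighbours in `G`.
    push Not at hxyS
    refine hfin w (Subtype.val '' S) (fun v hv ⟨t, ht, he⟩ => ?_) (hG (Subtype.val '' S) z ?_ ?_ ?_ w)
    · subst he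
      exact ht
    · exact hS.image _
    · rintro ⟨t, ht, he⟩
      exact hz (Subtype.ext he ▸ ht)
    · rintro _ ⟨t, ht, rfl⟩ b hab
      have htA : t.1 ∈ A := by
        rcases h.cover t with h1 | h1 | h1 | h1
        · exact h1
        · exact absurd h1 t.2
        · exact absurd ht (by rw [show t = ⟨x, h.left_notMem_right⟩ from Subtype.ext h1]
                              exact hxyS.1)
        · exact absurd ht (by rw [show t = ⟨y, h.right_notMem_right⟩ from Subtype.ext h1]
                              exact hxyS.2)
      have hb : b ∉ B := fun hb => h.not_adj t htA b hb hab
      rcases hcl t ht ⟨b, hb⟩ (hadj _ _ hab) with h1 | h1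
      · exact Or.inl ⟨_, h1, rfl⟩
      · exact Or.inr (congrArg Subtype.val h1)

lemma IsTwoSeparation.minDegThree_torso (h : IsTwoSeparation G A B x y) (hG : TwoConn G)
    (hd : MinDegThree G) (hx : ∀ c, ∃ a ∈ A, G.Adj x a ∧ a ≠ c)
    (hy : ∀ c, ∃ a ∈ A, G.Adj y a ∧ a ≠ c) : MinDegThree (torso G Bᶜ x y) := by
  have hxy := h.ne hG
  have aux : ∀ {x y : V} (_ : IsTwoSeparation G A B x y) (_ : x ≠ y)
      (_ : ∀ c, ∃ a ∈ A, G.Adj x a ∧ a ≠ c) (a b : V),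
      ∃ c, c ∉ B ∧ (G.Adj x c ∨ c = y) ∧ c ≠ a ∧ c ≠ b ∧ x ≠ c := by
    intro x y h hxy hx a b
    by_cases hya : y = a
    · obtain ⟨c, hc, hxc, hcb⟩ := hx b
      refine ⟨c, h.disjoint c hc, .inl hxc, ?_, hcb, hxc.ne⟩
      rintro rfl
      exact h.right_notMem_left (hya ▸ hc)
    · by_cases hyb : y = b
      · obtain ⟨c, hc, hxc, hca⟩ := hx a
        refine ⟨c, h.disjoint c hc, .inl hxc, hca, ?_, hxc.ne⟩
        rintro rfl
        exact h.right_notMem_left (hyb ▸ hc)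
      · exact ⟨y, h.right_notMem_right, .inr rfl, hya, hyb, hxy⟩
  intro v a b
  rcases h.cover v with hv | hv | hv | hv
  · obtain ⟨c, hvc, hca, hcb⟩ := hd v a b
    exact ⟨⟨c, fun hc => h.not_adj v hv c hc hvc⟩, ⟨fun e => hvc.ne (congrArg Subtype.val e),
      .inl hvc⟩, fun e => hca (congrArg Subtype.val e), fun e => hcb (congrArg Subtype.val e)⟩
  · exact absurd hv v.2
  · obtain ⟨c, hc, hvc, hca, hcb, hne⟩ := aux h hxy hx a b
    exact ⟨⟨c, hc⟩, ⟨fun e => hne (hv ▸ congrArg Subtype.val e),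
      hvc.imp (fun h => hv ▸ h) fun h => .inl ⟨hv, h⟩⟩, fun e => hca (congrArg Subtype.val e),
      fun e => hcb (congrArg Subtype.val e)⟩
  · obtain ⟨c, hc, hvc, hca, hcb, hne⟩ := aux h.swap hxy.symm hy a b
    exact ⟨⟨c, hc⟩, ⟨fun e => hne (hv ▸ congrArg Subtype.val e),
      hvc.imp (fun h => hv ▸ h) fun h => .inr ⟨hv, h⟩⟩, fun e => hca (congrArg Subtype.val e),
      fun e => hcb (congrArg Subtype.val e)⟩

/-- Contracting an edge that does not separate the graph preserves `TwoConn`. -/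
lemma TwoConn.contractInto (hG : TwoConn G) {u v : V} (huv : u ≠ v)
    (hc : ∀ A : Set V, A.Nonempty → u ∉ A → v ∉ A →
      (∀ a ∈ A, ∀ b, G.Adj a b → b ∈ A ∨ b = u ∨ b = v) → ∀ w, w ∈ A ∨ w = u ∨ w = v) :
    TwoConn (contractInto G u v) := by
  intro S z hS hz hcl w
  have hadj : ∀ a b : {w // w ≠ v}, G.Adj a b → (_root_.contractInto G u v).Adj a b :=
    fun a b hab => ⟨fun e => hab.ne (congrArg Subtype.val e), Or.inl hab⟩
  by_cases huS : (⟨u, huv⟩ : {w // w ≠ v}) ∈ S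
  · have := hG (insert v (Subtype.val '' S)) z ⟨v, .inl rfl⟩ ?_ ?_ w
    · rcases this with (h1 | ⟨t, ht, h1⟩) | h1
      · exact absurd h1 w.2
      · exact .inl (Subtype.ext h1 ▸ ht)
      · exact .inr (Subtype.ext h1)
    · rintro (h1 | ⟨t, ht, h1⟩)
      · exact z.2 h1
      · exact hz (Subtype.ext h1 ▸ ht)
    · intro a ha b hab
      by_cases hb : b = v
      · exact .inl (.inl hb)
      have : (⟨b, hb⟩ : {w // w ≠ v}) ∈ S ∨ (⟨b, hb⟩ : {w // w ≠ v}) = z := by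
        rcases ha with rfl | ⟨t, ht, rfl⟩
        · by_cases hbu : u = b
          · subst hbu
            exact .inl huS
          · exact hcl _ huS _ ⟨fun e => hbu (congrArg Subtype.val e), .inr (.inl ⟨rfl, hab⟩)⟩
        · exact hcl _ ht _ (hadj _ _ hab)
      rcases this with h1 | h1
      · exact .inl (.inr ⟨_, h1, rfl⟩)
      · exact .inr (congrArg Subtype.val h1)
  · have hvS : v ∉ Subtype.val '' S := fun ⟨t, _, h⟩ => t.2 h
    have hfin : w.1 ∈ Subtype.val '' S ∨ w.1 = z.1 → w ∈ S ∨ w = z := by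
      rintro (⟨t, ht, h1⟩ | h1)
      · exact .inl (Subtype.ext h1 ▸ ht)
      · exact .inr (Subtype.ext h1)
    by_cases hva : ∃ a ∈ S, G.Adj v a
    · obtain ⟨a, ha, hva⟩ := hva
      have hzu : u = z.1 := congrArg Subtype.val ((hcl a ha ⟨u, huv⟩
        ⟨fun e => huS (e ▸ ha), .inr (.inr ⟨rfl, hva⟩)⟩).resolve_left huS)
      have := hc (Subtype.val '' S) (hS.image _) (fun ⟨t, ht, h1⟩ => huS (by
        rwa [show (⟨u, huv⟩ : {w // w ≠ v}) = t from Subtype.ext h1.symm])) hvS ?_ w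
      · rw [hzu] at this
        have := w.2
        tauto
      · rintro _ ⟨t, ht, rfl⟩ b hab
        by_cases hb : b = v
        · exact .inr (.inr hb)
        rcases hcl t ht ⟨b, hb⟩ (hadj _ _ hab) with h1 | h1
        · exact .inl ⟨_, h1, rfl⟩
        · exact .inr (.inl (hzu ▸ congrArg Subtype.val h1))
    · push Not at hva
      refine hfin (hG (Subtype.val '' S) z (hS.image _) ?_ ?_ w)
      · rintro ⟨t, ht, h1⟩
        exact hz (Subtype.ext h1 ▸ ht)
      · rintro _ ⟨t, ht, rfl⟩ b hab
        have hb : b ≠ v := fun hb => hva t ht (hb ▸ hab.symm)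
        rcases hcl t ht ⟨b, hb⟩ (hadj _ _ hab) with h1 | h1
        · exact .inl ⟨_, h1, rfl⟩
        · exact .inr (congrArg Subtype.val h1)

/-- Contracting an edge `uv` preserves `MinDegThree` if the common neighbours of `u` and `v` have
degree at least four, and `u`, `v` have between them three further neighbours. -/
lemma MinDegThree.contractInto (hd : MinDegThree G) {u v : V} (huv : u ≠ v)
    (hw : ∀ w, G.Adj w u → G.Adj w v → ∀ a b, ∃ c, G.Adj w c ∧ c ≠ a ∧ c ≠ b ∧ c ≠ v)
    (hm : ∀ a b, ∃ c, (G.Adj u c ∨ G.Adj v c) ∧ c ≠ a ∧ c ≠ b ∧ c ≠ u ∧ c ≠ v) :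
    MinDegThree (contractInto G u v) := by
  intro w a b
  by_cases hwu : w.1 = u
  · obtain ⟨c, hc, hca, hcb, hcu, hcv⟩ := hm a b
    exact ⟨⟨c, hcv⟩, ⟨fun e => hcu (hwu ▸ (congrArg Subtype.val e).symm),
      hc.imp (fun h => hwu ▸ h) fun h => .inl ⟨hwu, h⟩⟩, fun e => hca (congrArg Subtype.val e),
      fun e => hcb (congrArg Subtype.val e)⟩
  have fin : ∀ c, c ≠ v → (G.Adj w c ∨ c = u ∧ G.Adj v w) → c ≠ a → c ≠ b →
      ∃ c, (_root_.contractInto G u v).Adj w c ∧ c ≠ a ∧ c ≠ b := by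
    intro c hcv hc hca hcb
    refine ⟨⟨c, hcv⟩, ⟨fun e => ?_, hc.imp id .inr⟩, fun e => hca (congrArg Subtype.val e),
      fun e => hcb (congrArg Subtype.val e)⟩
    have e : w.1 = c := congrArg Subtype.val e
    rcases hc with hc | hc
    · exact hc.ne e
    · exact hwu (e.trans hc.1)
  by_cases hwv : G.Adj w v
  · by_cases hwu' : G.Adj w u
    · obtain ⟨c, hwc, hca, hcb, hcv⟩ := hw w hwu' hwv a b
      exact fin c hcv (.inl hwc) hca hcb
    · by_cases hu : u ≠ a ∧ u ≠ b
      · exact fin u huv (.inr ⟨rfl, hwv.symm⟩) hu.1 hu.2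
      · by_cases hua : u = a
        · obtain ⟨c, hwc, hcb, hcv⟩ := hd w b v
          exact fin c hcv (.inl hwc) (fun e => hwu' (hua ▸ e ▸ hwc)) hcb
        · obtain ⟨c, hwc, hca, hcv⟩ := hd w a v
          have hub : u = b := by tauto
          exact fin c hcv (.inl hwc) hca (fun e => hwu' (hub ▸ e ▸ hwc))
  · obtain ⟨c, hwc, hca, hcb⟩ := hd w a b
    exact fin c (fun e => hwv (e ▸ hwc)) (.inl hwc) hca hcb

end Connectivity

/-! ### The structure theorem -/

section ForbiddenMinors

variable {V : Type*} {G : SimpleGraph V}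

lemma hasMinorModel_wheelFour {p q p' q' h : V} (hp : p ≠ p') (hq : q ≠ q') (h01 : G.Adj p q)
    (h12 : G.Adj q p') (h23 : G.Adj p' q') (h30 : G.Adj q' p) (h0 : G.Adj h p) (h1 : G.Adj h q)
    (h2 : G.Adj h p') (h3 : G.Adj h q') : HasMinorModel wheelFour G := by
  refine .of_injective_hom ⟨![p, q, p', q', h], fun {a b} hab => ?_⟩ ?_
  · rw [wheelFour, SimpleGraph.fromEdgeSet_adj] at hab
    fin_cases a <;> fin_cases b <;> simp at hab <;>
      first | assumption | exact SimpleGraph.Adj.symm (by assumption)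
  · intro a b hab
    have := h01.ne; have := h12.ne; have := h23.ne; have := h30.ne
    have := h0.ne; have := h1.ne; have := h2.ne; have := h3.ne
    fin_cases a <;> fin_cases b <;> simp at hab <;> first | rfl | (exfalso; grind)

lemma hasMinorModel_kFourPlusKFour {x y a b c d : V} (hxy : x ≠ y) (hac : a ≠ c) (had : a ≠ d)
    (hbc : b ≠ c) (hbd : b ≠ d) (hxa : G.Adj x a) (hxb : G.Adj x b) (hya : G.Adj y a)
    (hyb : G.Adj y b) (hab : G.Adj a b) (hxc : G.Adj x c) (hxd : G.Adj x d) (hyc : G.Adj y c)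
    (hyd : G.Adj y d) (hcd : G.Adj c d) : HasMinorModel kFourPlusKFour G := by
  refine .of_injective_hom ⟨![x, y, a, b, c, d], fun {s t} hst => ?_⟩ ?_
  · rw [kFourPlusKFour, SimpleGraph.fromEdgeSet_adj] at hst
    fin_cases s <;> fin_cases t <;> simp at hst <;>
      first | assumption | exact SimpleGraph.Adj.symm (by assumption)
  · intro s t hst
    have := hxa.ne; have := hxb.ne; have := hya.ne; have := hyb.ne; have := hab.ne
    have := hxc.ne; have := hxd.ne; have := hyc.ne; have := hyd.ne; have := hcd.ne
    fin_cases s <;> fin_cases t <;> simp at hst <;> first | rfl | (exfalso; grind)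

/-- The complement of a graph on five vertices with minimum degree three is a matching, so the
graph contains the complement `W₄` of two disjoint edges. -/
lemma MinDegThree.hasMinorModel_wheelFour [Finite V] (hd : MinDegThree G) (h5 : Nat.card V = 5) :
    HasMinorModel wheelFour G := by
  classical
  have := Fintype.ofFinite V
  rw [Nat.card_eq_fintype_card] at h5
  have two : ∀ v a b : V, v ≠ a → v ≠ b → a ≠ b →
      ∃ c d, ∀ w, w = v ∨ w = a ∨ w = b ∨ w = c ∨ w = d := by
    intro v a b hva hvb hab
    have hc : (({v, a, b} : Finset V)ᶜ).card = 2 := by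
      rw [Finset.card_compl, h5, Finset.card_eq_three.2 ⟨v, a, b, hva, hvb, hab, rfl⟩]
    obtain ⟨c, d, -, hcd⟩ := Finset.card_eq_two.1 hc
    refine ⟨c, d, fun w => ?_⟩
    by_cases hw : w ∈ ({v, a, b} : Finset V)
    · simp only [Finset.mem_insert, Finset.mem_singleton] at hw
      tauto
    · rw [← Finset.mem_compl, hcd, Finset.mem_insert, Finset.mem_singleton] at hw
      tauto
  have matching : ∀ v a b, v ≠ a → v ≠ b → a ≠ b → ¬ G.Adj v a → G.Adj v b := by
    intro v a b hva hvb hab hna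
    by_contra hnb
    obtain ⟨c, d, hcd⟩ := two v a b hva hvb hab
    obtain ⟨w, hvw, hwc, hwd⟩ := hd v c d
    rcases hcd w with rfl | rfl | rfl | rfl | rfl
    · exact hvw.ne rfl
    · exact hna hvw
    · exact hnb hvw
    · exact hwc rfl
    · exact hwd rfl
  have three : ∀ p p' : V, p ≠ p' → ∃ a b c, a ≠ b ∧ a ≠ c ∧ b ≠ c ∧ a ≠ p ∧ a ≠ p' ∧ b ≠ p ∧
      b ≠ p' ∧ c ≠ p ∧ c ≠ p' := by
    intro p p' hp
    have hc : (({p, p'} : Finset V)ᶜ).card = 3 := by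
      rw [Finset.card_compl, h5, Finset.card_eq_two.2 ⟨p, p', hp, rfl⟩]
    obtain ⟨a, b, c, hab, hac, hbc, he⟩ := Finset.card_eq_three.1 hc
    have ha : a ∈ ({p, p'} : Finset V)ᶜ := by simp [he]
    have hb : b ∈ ({p, p'} : Finset V)ᶜ := by simp [he]
    have hc : c ∈ ({p, p'} : Finset V)ᶜ := by simp [he]
    simp only [Finset.mem_compl, Finset.mem_insert, Finset.mem_singleton, not_or] at ha hb hc
    exact ⟨a, b, c, hab, hac, hbc, ha.1, ha.2, hb.1, hb.2, hc.1, hc.2⟩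
  have main : ∀ p p' q q' h : V, p ≠ p' → q ≠ q' → q ≠ p → q ≠ p' → q' ≠ p → q' ≠ p' →
      h ≠ p → h ≠ p' → h ≠ q → h ≠ q' →
      (∀ t, t ≠ p → t ≠ p' → G.Adj t p ∧ G.Adj t p') →
      G.Adj h q → G.Adj h q' → HasMinorModel wheelFour G := by
    intro p p' q q' h hp hq h1 h2 h3 h4 h5 h6 h7 h8 hall ha hb
    exact _root_.hasMinorModel_wheelFour hp hq (hall q h1 h2).1.symm (hall q h1 h2).2
      (hall q' h3 h4).2.symm (hall q' h3 h4).1 (hall h h5 h6).1 ha (hall h h5 h6).2 hb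
  -- A nonadjacent pair, if there is one, serves as a pair of opposite rim vertices.
  obtain ⟨p, p', hp, hall⟩ : ∃ p p', p ≠ p' ∧ ∀ t, t ≠ p → t ≠ p' → G.Adj t p ∧ G.Adj t p' := by
    by_cases hex : ∃ p p', p ≠ p' ∧ ¬ G.Adj p p'
    · obtain ⟨p, p', hp, hn⟩ := hex
      exact ⟨p, p', hp, fun t ht ht' => ⟨(matching p p' t hp ht.symm ht'.symm hn).symm,
        (matching p' p t hp.symm ht'.symm ht.symm (fun h => hn h.symm)).symm⟩⟩
    · push Not at hex
      have : Nontrivial V := Fintype.one_lt_card_iff_nontrivial.1 (by omega)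
      obtain ⟨p, p', hp⟩ := exists_pair_ne V
      exact ⟨p, p', hp, fun t ht ht' => ⟨hex t p ht, hex t p' ht'⟩⟩
  obtain ⟨a, b, c, hab, hac, hbc, hap, hap', hbp, hbp', hcp, hcp'⟩ := three p p' hp
  by_cases h1 : G.Adj a b
  · by_cases h2 : G.Adj a c
    · exact main p p' b c a hp hbc hbp hbp' hcp hcp' hap hap' hab hac hall h1 h2
    · exact main p p' a c b hp hac hap hap' hcp hcp' hbp hbp' hab.symm hbc hall h1.symm
        (matching c a b hac.symm hbc.symm hab (fun h => h2 h.symm)).symm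
  · exact main p p' a b c hp hab hap hap' hbp hbp' hcp hcp' hac.symm hbc.symm hall
      (matching a b c hab hac hbc h1).symm
      (matching b a c hab.symm hbc hac (fun h => h1 h.symm)).symm

lemma exists_ne_of_five_lt_card [Finite V] (h6 : 6 ≤ Nat.card V) (a b c d e : V) :
    ∃ w, w ≠ a ∧ w ≠ b ∧ w ≠ c ∧ w ≠ d ∧ w ≠ e := by
  classical
  have := Fintype.ofFinite V
  rw [Nat.card_eq_fintype_card] at h6
  by_contra! h
  have : (Finset.univ : Finset V) ⊆ {a, b, c, d, e} := by
    intro w _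
    have := h w
    simp only [Finset.mem_insert, Finset.mem_singleton]
    tauto
  have := (Finset.card_le_card this).trans Finset.card_le_five
  rw [Finset.card_univ] at this
  omega

/-- If every edge lies in a triangle whose third vertex has degree three, then some triangle
consists of vertices of degree three, and it has at most two outside neighbours. Hence a graph on
at least six vertices without separation of order two has an edge whose ends have no common
neighbour of degree three. -/
lemma exists_adj_forall_common_neighbor [Finite V] (hd : MinDegThree G) (h6 : 6 ≤ Nat.card V)
    (h3 : ∀ A B x y, ¬ IsTwoSeparation G A B x y) :
    ∃ u v, G.Adj u v ∧
      ∀ w, G.Adj w u → G.Adj w v → ∀ a b, ∃ c, G.Adj w c ∧ c ≠ a ∧ c ≠ b ∧ c ≠ v := by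
  by_contra! hc
  have wit : ∀ u v, G.Adj u v → ∃ w t, G.Adj w u ∧ G.Adj w v ∧
      ∀ c, G.Adj w c → c = u ∨ c = v ∨ c = t := by
    intro u v huv
    obtain ⟨w, hwu, hwv, a, b, hab⟩ := hc u v huv
    have hne := huv.ne
    by_cases hua : u = a
    · refine ⟨w, b, hwu, hwv, fun c hwc => ?_⟩
      have := hab c hwc
      subst hua
      tauto
    · refine ⟨w, a, hwu, hwv, fun c hwc => ?_⟩
      have h1 := hab c hwc
      have h2 := hab u hwu
      have : u = b := by tauto
      subst this
      tauto
  obtain ⟨v₀⟩ : Nonempty V := (Nat.card_pos_iff.1 (by omega)).1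
  obtain ⟨u₀, huv, -⟩ := hd v₀ v₀ v₀
  obtain ⟨w, t, hwu, hwv, hw⟩ := wit _ _ huv
  obtain ⟨j, t', hjw, hju, hj⟩ := wit w v₀ hwu
  obtain ⟨l, s, hlw, hlj, hl⟩ := wit w j hjw.symm
  obtain ⟨p, hwp, hpj, hpl⟩ := hd w j l
  obtain ⟨q, hjq, hqw, hql⟩ := hd j w l
  obtain ⟨s', hls, hsw, hsj⟩ := hd l w j
  -- The neighbourhoods of the vertices of the triangle `w j l`.
  have hs : s' = s := by have := hl s' hls; tauto
  subst hs
  have hw' : ∀ c, G.Adj w c → c = j ∨ c = l ∨ c = p := by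
    intro c hwc
    have h1 := hw c hwc; have h2 := hw j hjw.symm; have h3 := hw l hlw.symm; have h4 := hw p hwp
    have := hlj.ne
    grind
  have hj' : ∀ c, G.Adj j c → c = w ∨ c = l ∨ c = q := by
    intro c hjc
    have h1 := hj c hjc; have h3 := hj l hlj.symm; have h4 := hj q hjq
    have := hlw.ne
    grind
  obtain ⟨z, -, hzw, hzp, -⟩ := wit w p hwp
  have sep : ∀ p s, p ≠ w → p ≠ j → p ≠ l → s ≠ w → s ≠ j → s ≠ l →
      (∀ c, G.Adj w c → c = j ∨ c = l ∨ c = p ∨ c = s) →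
      (∀ c, G.Adj j c → c = w ∨ c = l ∨ c = p ∨ c = s) →
      (∀ c, G.Adj l c → c = w ∨ c = j ∨ c = p ∨ c = s) → False := by
    intro p s h1 h2 h3' h4 h5 h6' hw hj hl
    obtain ⟨e, he⟩ := exists_ne_of_five_lt_card h6 w j l p s
    refine h3 {w, j, l} {c | c ≠ w ∧ c ≠ j ∧ c ≠ l ∧ c ≠ p ∧ c ≠ s} p s
      ⟨⟨w, by simp⟩, ⟨e, he⟩, ?_, ?_, ?_, ?_, ?_, ?_, ?_⟩
    · rintro v (rfl | rfl | rfl) hv <;> simp at hv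
    · simp [h1, h2, h3']
    · simp [h4, h5, h6']
    · simp
    · simp
    · intro v
      simp only [Set.mem_insert_iff, Set.mem_singleton_iff, Set.mem_ofPred_eq]
      tauto
    · rintro v (rfl | rfl | rfl) c hcc hvc <;> simp only [Set.mem_ofPred_eq] at hcc
      · have := hw c hvc; tauto
      · have := hj c hvc; tauto
      · have := hl c hvc; tauto
  have hz := hw' z hzw.symm
  have hpz := hzp.ne
  rcases hz with rfl | rfl | rfl
  · have hpq : p = q := by
      have := hj' p hzp
      have := hwp.ne
      grind
    subst hpq
    refine sep p s' hwp.ne' hpj hpl hsw hsj hls.ne' ?_ ?_ ?_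
    · intro c hcw; have := hw' c hcw; tauto
    · intro c hcw; have := hj' c hcw; tauto
    · intro c hcw; have := hl c hcw; tauto
  · have hps : p = s' := by
      have := hl p hzp
      have := hwp.ne
      grind
    subst hps
    refine sep p q hwp.ne' hpj hpl hqw hjq.ne' hql ?_ ?_ ?_
    · intro c hcw; have := hw' c hcw; tauto
    · intro c hcw; have := hj' c hcw; tauto
    · intro c hcw; have := hl c hcw; tauto
  · exact hpz rfl

variable {A B : Set V} {x y : V}

/-- In a separation with smallest possible left side, each separating vertex has two neighbours on
that side: a unique neighbour could replace it as a separating vertex. -/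
lemma IsTwoSeparation.exists_adj_ne [Finite V] (h : IsTwoSeparation G A B x y) (hG : TwoConn G)
    (hd : MinDegThree G)
    (hmin : ∀ A' B' x' y', IsTwoSeparation G A' B' x' y' → A.ncard ≤ A'.ncard) (c : V) :
    ∃ a ∈ A, G.Adj x a ∧ a ≠ c := by
  by_contra! hc
  obtain ⟨a, ha, hxa⟩ := h.exists_adj hG
  obtain rfl := hc a ha hxa
  obtain ⟨t, hat, htx, hty⟩ := hd a x y
  have hsep : IsTwoSeparation G (A \ {a}) (insert x B) a y := by
    refine ⟨⟨t, ?_, hat.ne'⟩, ⟨x, .inl rfl⟩, ?_, fun h => h.2 rfl,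
      fun hy => h.right_notMem_left hy.1, ?_, ?_, ?_, ?_⟩
    · rcases h.cover t with h1 | h1 | h1 | h1
      · exact h1
      · exact absurd hat (h.not_adj a ha t h1)
      · exact absurd h1 htx
      · exact absurd h1 hty
    · rintro v ⟨hv, -⟩ (rfl | hv')
      · exact h.left_notMem_left hv
      · exact h.disjoint v hv hv'
    · rintro (rfl | hv')
      · exact h.left_notMem_left ha
      · exact h.disjoint a ha hv'
    · rintro (hv | hv)
      · exact h.ne hG hv.symm
      · exact h.right_notMem_right hv
    · intro v
      have := h.cover v
      simp only [Set.mem_sdiff, Set.mem_singleton_iff, Set.mem_insert_iff]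
      tauto
    · rintro v ⟨hv, hva⟩ b (rfl | hb) hvb
      · exact hva (hc v hv hvb.symm)
      · exact h.not_adj v hv b hb hvb
  exact absurd (hmin _ _ _ _ hsep) (not_le.2 (Set.ncard_sdiff_singleton_lt_of_mem ha))

lemma IsTwoSeparation.eq_pair [Finite V] (h : IsTwoSeparation G A B x y) (hd : MinDegThree G)
    (hA : A.ncard ≤ 2) :
    ∃ a b, A = {a, b} ∧ G.Adj a b ∧ G.Adj x a ∧ G.Adj x b ∧ G.Adj y a ∧ G.Adj y b := by
  have hmem : ∀ a ∈ A, ∀ t, G.Adj a t → t ∈ A ∨ t = x ∨ t = y := fun a ha t hat => by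
    have := h.cover t
    have := h.not_adj a ha t
    tauto
  have h0 : 0 < A.ncard := (Set.ncard_pos).2 h.left_nonempty
  have h2 : A.ncard = 2 := by
    by_contra h2
    obtain ⟨a, rfl⟩ := Set.ncard_eq_one.1 (show A.ncard = 1 by omega)
    obtain ⟨t, hat, htx, hty⟩ := hd a x y
    rcases hmem a rfl t hat with h1 | h1 | h1
    · exact hat.ne' h1
    · exact htx h1
    · exact hty h1
  obtain ⟨a, b, hab, rfl⟩ := Set.ncard_eq_two.1 h2
  have all : ∀ a b : V, (∀ t, G.Adj a t → (t = a ∨ t = b) ∨ t = x ∨ t = y) →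
      G.Adj a b ∧ G.Adj x a ∧ G.Adj y a := by
    intro a b hm
    refine ⟨?_, ?_, ?_⟩
    · obtain ⟨t, hat, h1, h2⟩ := hd a x y
      have := hm t hat; have := hat.ne'
      obtain rfl : t = b := by tauto
      exact hat
    · obtain ⟨t, hat, h1, h2⟩ := hd a b y
      have := hm t hat; have := hat.ne'
      obtain rfl : t = x := by tauto
      exact hat.symm
    · obtain ⟨t, hat, h1, h2⟩ := hd a b x
      have := hm t hat; have := hat.ne'
      obtain rfl : t = y := by tauto
      exact hat.symm
  obtain ⟨h1, h2, h3⟩ := all a b (fun t ht => hmem a (.inl rfl) t ht)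
  obtain ⟨-, h4, h5⟩ := all b a (fun t ht => by have := hmem b (.inr rfl) t ht; simp at this; tauto)
  exact ⟨a, b, rfl, h1, h2, h4, h3, h5⟩

lemma IsTwoSeparation.card_compl [Finite V] (h : IsTwoSeparation G A B x y) (hG : TwoConn G) :
    Nat.card (Bᶜ : Set V) = A.ncard + 2 := by
  have : Bᶜ = insert x (insert y A) := by
    ext v
    have h1 := h.cover v
    have h2 := h.disjoint v
    have h3 := h.left_notMem_right
    have h4 := h.right_notMem_right
    simp only [Set.mem_compl_iff, Set.mem_insert_iff]
    constructor
    · tauto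
    · rintro (rfl | rfl | h5) <;> tauto
  rw [Nat.card_coe_set_eq, this, Set.ncard_insert_of_notMem, Set.ncard_insert_of_notMem]
  · exact h.right_notMem_left
  · rintro (h1 | h1)
    · exact h.ne hG h1
    · exact h.left_notMem_left h1

/-- If one side of a two-separation is a pair `a`, `b`, and the separating vertex `x` has only one
neighbour `x₁` on the other side, then contracting `xx₁` preserves connectivity and degrees. -/
lemma IsTwoSeparation.contractInto {a b x₁ : V} (h : IsTwoSeparation G {a, b} B x y)
    (hG : TwoConn G) (hd : MinDegThree G) (hab : G.Adj a b) (hxa : G.Adj x a) (hxb : G.Adj x b)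
    (hya : G.Adj y a) (hyb : G.Adj y b) (hB : ∀ c ∈ B, G.Adj x c → c = x₁) (hx₁ : x₁ ∈ B)
    (hxx₁ : G.Adj x₁ x) :
    TwoConn (contractInto G x₁ x) ∧ MinDegThree (contractInto G x₁ x) := by
  have hna : ∀ c ∈ B, ¬ G.Adj a c := h.not_adj a (.inl rfl)
  have hnb : ∀ c ∈ B, ¬ G.Adj b c := h.not_adj b (.inr rfl)
  have hx₁a : x₁ ≠ a := fun e => h.disjoint a (.inl rfl) (e ▸ hx₁)
  have hx₁b : x₁ ≠ b := fun e => h.disjoint b (.inr rfl) (e ▸ hx₁)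
  have hcov : ∀ v, (v = a ∨ v = b) ∨ v ∈ B ∨ v = x ∨ v = y := h.cover
  refine ⟨hG.contractInto hxx₁.ne ?_, hd.contractInto hxx₁.ne ?_ ?_⟩
  · intro C hC hx₁C hxC hcl w
    by_contra! hw
    obtain ⟨hwC, hwx₁, hwx⟩ := hw
    by_cases hmeet : a ∈ C ∨ b ∈ C ∨ y ∈ C
    · -- The set `C` contains `a`, `b` and `y`, so its complement is separated by `x₁` alone.
      have hyx : y ≠ x := (h.ne hG).symm
      have hyx₁ : y ≠ x₁ := fun e => h.right_notMem_right (e ▸ hx₁)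
      have h1 : a ∈ C → b ∈ C := fun ha => by
        have := hcl a ha b hab; have := hxb.ne'; tauto
      have h2 : b ∈ C → a ∈ C := fun hb => by
        have := hcl b hb a hab.symm; have := hxa.ne'; tauto
      have h3 : a ∈ C → y ∈ C := fun ha => by
        have := hcl a ha y hya.symm; tauto
      have h4 : y ∈ C → a ∈ C := fun hy => by
        have := hcl y hy a hya; have := hxa.ne'; tauto
      have ha : a ∈ C := by tauto
      have hb := h1 ha
      have hy := h3 ha
      have hsub : ∀ v, v ∉ C → v ≠ x → v ∈ B := fun v hv hvx => by
        rcases hcov v with (rfl | rfl) | h5 | h5 | rfl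
        · exact absurd ha hv
        · exact absurd hb hv
        · exact h5
        · exact absurd h5 hvx
        · exact absurd hy hv
      rcases hG {v | v ∉ C ∧ v ≠ x ∧ v ≠ x₁} x₁ ⟨w, hwC, hwx, hwx₁⟩ (fun h => h.2.2 rfl) (by
        rintro v ⟨hv, hvx, hvx₁⟩ c hvc
        by_cases hcx₁ : c = x₁
        · exact .inr hcx₁
        · refine .inl ⟨fun hcC => ?_, ?_, hcx₁⟩
          · have := hcl c hcC v hvc.symm
            tauto
          · rintro rfl
            exact hvx₁ (hB v (hsub v hv hvx) hvc.symm)) a with h5 | h5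
      · exact h5.1 ha
      · exact hx₁a h5.symm
    · -- The set `C` lies in `B`, so it is separated by `x₁` alone.
      push Not at hmeet
      obtain ⟨ha, hb, hy⟩ := hmeet
      rcases hG C x₁ hC hx₁C (fun v hv c hvc => by
        rcases hcl v hv c hvc with h5 | h5 | rfl
        · exact .inl h5
        · exact .inr h5
        · rcases hcov v with (rfl | rfl) | h6 | rfl | rfl
          · exact absurd hv ha
          · exact absurd hv hb
          · exact absurd hv (hB v h6 hvc.symm ▸ hx₁C)
          · exact absurd hv hxC
          · exact absurd hv hy) a with h5 | h5
      · exact ha h5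
      · exact hx₁a h5.symm
  · intro w hwx₁ hwx s t
    have hwy : w = y := by
      rcases hcov w with (rfl | rfl) | h6 | rfl | rfl
      · exact absurd hwx₁ (hna _ hx₁)
      · exact absurd hwx₁ (hnb _ hx₁)
      · exact absurd hwx₁.ne (not_not.2 (hB w h6 hwx.symm))
      · exact absurd rfl hwx.ne
      · rfl
    subst hwy
    have h1 := hxa.ne'; have h2 := hxb.ne'; have h3 := hxx₁.ne; have h4 := hab.ne
    by_cases ha : a ≠ s ∧ a ≠ t
    · exact ⟨a, hya, ha.1, ha.2, h1⟩
    · by_cases hb : b ≠ s ∧ b ≠ t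
      · exact ⟨b, hyb, hb.1, hb.2, h2⟩
      · exact ⟨x₁, hwx₁, by grind, by grind, h3⟩
  · intro s t
    have h1 := hxa.ne'; have h2 := hxb.ne'; have h4 := hab.ne
    by_cases ha : a ≠ s ∧ a ≠ t
    · exact ⟨a, .inr hxa, ha.1, ha.2, hx₁a.symm, h1⟩
    · by_cases hb : b ≠ s ∧ b ≠ t
      · exact ⟨b, .inr hxb, hb.1, hb.2, hx₁b.symm, h2⟩
      · obtain ⟨c, hc, hcx, -⟩ := hd x₁ x x
        have hca : c ≠ a := fun e => hna x₁ hx₁ (e ▸ hc.symm)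
        have hcb : c ≠ b := fun e => hnb x₁ hx₁ (e ▸ hc.symm)
        exact ⟨c, .inl hc, by grind, by grind, hc.ne', hcx⟩

lemma isTwoSeparation_or_forall (G : SimpleGraph V) (u v : V) (A : Set V)
    (hA : A.Nonempty) (hu : u ∉ A) (hv : v ∉ A)
    (hcl : ∀ a ∈ A, ∀ b, G.Adj a b → b ∈ A ∨ b = u ∨ b = v) :
    IsTwoSeparation G A {w | w ∉ A ∧ w ≠ u ∧ w ≠ v} u v ∨ ∀ w, w ∈ A ∨ w = u ∨ w = v := by
  by_cases h : ∀ w, w ∈ A ∨ w = u ∨ w = v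
  · exact .inr h
  · push Not at h
    refine .inl ⟨hA, h, fun v hv hv' => hv'.1 hv, hu, hv, fun h => h.2.1 rfl, fun h => h.2.2 rfl,
      fun w => ?_, fun a ha b hb hab => ?_⟩
    · simp only [Set.mem_ofPred_eq]
      tauto
    · have := hcl a ha b hab
      have := hb.1; have := hb.2.1; have := hb.2.2
      tauto

/-- The structure theorem: a graph on at least five vertices that is two-connected and has minimum
degree at least three has `W₄` or `K₄ +ₑ K₄` as a minor. -/
theorem TwoConn.hasMinorModel_wheelFour_or_kFourPlusKFour {n : ℕ} {V : Type u} [Finite V]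
    {G : SimpleGraph V} (hn : Nat.card V = n) (h5 : 5 ≤ n) (hG : TwoConn G) (hd : MinDegThree G) :
    HasMinorModel wheelFour G ∨ HasMinorModel kFourPlusKFour G := by
  induction n using Nat.strong_induction_on generalizing V with
  | _ n ih =>
  have step : ∀ {W : Type u} [Finite W] {H : SimpleGraph W}, HasMinorModel H G → Nat.card W < n →
      5 ≤ Nat.card W → TwoConn H → MinDegThree H →
      HasMinorModel wheelFour G ∨ HasMinorModel kFourPlusKFour G :=
    fun hHG hlt h5 hH hdH => (ih _ hlt rfl h5 hH hdH).imp (·.trans hHG) (·.trans hHG)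
  by_cases hn5 : n = 5
  · exact .inl (hd.hasMinorModel_wheelFour (hn.trans hn5))
  have h6 : 6 ≤ Nat.card V := by omega
  have hcontr : ∀ u v, G.Adj u v → TwoConn (_root_.contractInto G u v) →
      MinDegThree (_root_.contractInto G u v) →
      HasMinorModel wheelFour G ∨ HasMinorModel kFourPlusKFour G := by
    intro u v huv h1 h2
    have hc := Set.ncard_add_ncard_compl ({v} : Set V)
    rw [Set.ncard_singleton, hn] at hc
    have hc' : Nat.card {w // w ≠ v} = ({v}ᶜ : Set V).ncard := Nat.card_coe_set_eq _
    exact step (hasMinorModel_contractInto huv) (by omega) (by omega) h1 h2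
  by_cases h3 : ∀ A B x y, ¬ IsTwoSeparation G A B x y
  · obtain ⟨u, v, huv, hw⟩ := exists_adj_forall_common_neighbor hd h6 h3
    have hcl := fun A hA hu hv hcl => (isTwoSeparation_or_forall G u v A hA hu hv hcl).resolve_left
      (h3 _ _ _ _)
    refine hcontr u v huv (hG.contractInto huv.ne hcl) (hd.contractInto huv.ne hw fun a b => ?_)
    -- Otherwise `a` and `b` separate the set `{u, v}`.
    by_contra! hc
    have hne := huv.ne
    obtain ⟨c, huc, hcv, -⟩ := hd u v v
    have sep : ∀ a b, a ≠ u → a ≠ v → b ≠ u → b ≠ v → (∀ c, G.Adj u c ∨ G.Adj v c →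
        c = a ∨ c = b ∨ c = u ∨ c = v) → False := by
      intro a b hau hav hbu hbv hc
      rcases isTwoSeparation_or_forall G a b {u, v} ⟨u, .inl rfl⟩ (by simp [hau, hav])
        (by simp [hbu, hbv]) (by
          rintro w (rfl | rfl) c hwc
          · have := hc c (.inl hwc); simp; tauto
          · have := hc c (.inr hwc); simp; tauto) with h | h
      · exact h3 _ _ _ _ h
      · obtain ⟨w, h1, h2, h4, h5, -⟩ := exists_ne_of_five_lt_card h6 u v a b b
        rcases h w with (rfl | rfl) | rfl | rfl <;> contradiction
    have hcu := huc.ne'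
    have hc' : ∀ c, G.Adj u c ∨ G.Adj v c → c = a ∨ c = b ∨ c = u ∨ c = v := fun c h => by
      have := hc c h
      tauto
    -- At least one of `a`, `b` lies outside `{u, v}`; the other one may be replaced by it.
    have hcab := hc' c (.inl huc)
    by_cases ha : a = u ∨ a = v
    · obtain rfl : c = b := by grind
      exact sep c c hcu hcv hcu hcv fun d hd => by have := hc' d hd; grind
    · by_cases hb : b = u ∨ b = v
      · obtain rfl : c = a := by grind
        exact sep c c hcu hcv hcu hcv fun d hd => by have := hc' d hd; grind
      · push Not at ha hb
        exact sep a b ha.1 ha.2 hb.1 hb.2 hc'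
  · have hex : ∃ m, ∃ A B x y, IsTwoSeparation G A B x y ∧ A.ncard = m := by
      push Not at h3
      obtain ⟨A, B, x, y, h⟩ := h3
      exact ⟨_, A, B, x, y, h, rfl⟩
    classical
    obtain ⟨A, B, x, y, h, hA⟩ := Nat.find_spec hex
    have hmin : ∀ A' B' x' y', IsTwoSeparation G A' B' x' y' → A.ncard ≤ A'.ncard :=
      fun A' B' x' y' h' => hA ▸ Nat.find_min' hex ⟨A', B', x', y', h', rfl⟩
    have hlt : ∀ {A B : Set V}, IsTwoSeparation G A B x y → Nat.card (Bᶜ : Set V) < n := by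
      intro A B h
      rw [Nat.card_coe_set_eq, ← hn, ← Set.ncard_add_ncard_compl B]
      have := (Set.ncard_pos).2 h.right_nonempty
      omega
    by_cases hA2 : A.ncard ≤ 2
    · obtain ⟨a, b, rfl, hab, hxa, hxb, hya, hyb⟩ := h.eq_pair hd hA2
      have one : ∀ {x y} (_ : IsTwoSeparation G {a, b} B x y) (_ : G.Adj x a) (_ : G.Adj x b)
          (_ : G.Adj y a) (_ : G.Adj y b) (_ : ¬ ∀ c, ∃ a ∈ B, G.Adj x a ∧ a ≠ c),
          HasMinorModel wheelFour G ∨ HasMinorModel kFourPlusKFour G := by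
        intro x y h hxa hxb hya hyb hno
        push Not at hno
        obtain ⟨c, hc⟩ := hno
        obtain ⟨x₁, hx₁, hxx₁⟩ := h.symm.exists_adj hG
        obtain rfl := hc x₁ hx₁ hxx₁
        have := h.contractInto hG hd hab hxa hxb hya hyb hc hx₁ hxx₁.symm
        exact hcontr _ _ hxx₁.symm this.1 this.2
      by_cases hx : ∀ c, ∃ a ∈ B, G.Adj x a ∧ a ≠ c
      · by_cases hy : ∀ c, ∃ a ∈ B, G.Adj y a ∧ a ≠ c
        · by_cases hB2 : B.ncard ≤ 2
          · obtain ⟨c, d, rfl, hcd, hxc, hxd, hyc, hyd⟩ := h.symm.eq_pair hd hB2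
            have h1 := h.disjoint a (.inl rfl)
            have h2 := h.disjoint b (.inr rfl)
            simp only [Set.mem_insert_iff, Set.mem_singleton_iff, not_or] at h1 h2
            exact .inr (hasMinorModel_kFourPlusKFour (h.ne hG) h1.1 h1.2 h2.1 h2.2 hxa hxb hya hyb
              hab hxc hxd hyc hyd hcd)
          · exact step (h.symm.hasMinorModel_torso hG) (hlt h.symm)
              (by rw [h.symm.card_compl hG]; omega) (h.symm.twoConn_torso hG)
              (h.symm.minDegThree_torso hG hd hx hy)
        · exact one h.swap hya hyb hxa hxb hy
      · exact one h hxa hxb hya hyb hx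
    · exact step (h.hasMinorModel_torso hG) (hlt h) (by rw [h.card_compl hG]; omega)
        (h.twoConn_torso hG) (h.minDegThree_torso hG hd (h.exists_adj_ne hG hd hmin)
          (h.swap.exists_adj_ne hG hd hmin))

end ForbiddenMinors

/-! ### Realizability in the plane with the supremum norm -/

section Plane

/-- The distances along the edges of `G` of any family of points of a (pseudo)metric space are
realized by points of the plane with the supremum norm. As every finite metric space embeds
isometrically into some `ℓ_∞^m`, this is realizability in `ℓ_∞^2`. -/
def PlaneRealizable {V : Type*} (G : SimpleGraph V) : Prop :=
  ∀ (X : Type) [PseudoMetricSpace X] (r : V → X),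
    ∃ q : V → ℝ × ℝ, ∀ v w, G.Adj v w → dist (q v) (q w) = dist (r v) (r w)

lemma dist_eq_of_fst {s t s' t' d : ℝ} (h : s' - s = d) (h₁ : t' - t ≤ d) (h₂ : t - t' ≤ d) :
    dist ((s, t) : ℝ × ℝ) (s', t') = d := by
  have hd : 0 ≤ d := by linarith
  rw [Prod.dist_eq, dist_comm s, Real.dist_eq, Real.dist_eq, h, abs_of_nonneg hd]
  exact max_eq_left (abs_sub_le_iff.2 ⟨h₂, h₁⟩)

lemma dist_eq_of_snd {s t s' t' d : ℝ} (h : t' - t = d) (h₁ : s' - s ≤ d) (h₂ : s - s' ≤ d) :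
    dist ((s, t) : ℝ × ℝ) (s', t') = d := by
  have hd : 0 ≤ d := by linarith
  rw [Prod.dist_eq, dist_comm t, Real.dist_eq, Real.dist_eq, h, abs_of_nonneg hd]
  exact max_eq_right (abs_sub_le_iff.2 ⟨h₂, h₁⟩)

/-- Four points embed isometrically into the plane with the supremum norm. In the tight span of the
four points, a rectangle with sides `h`, `w` and a leg at each corner (of lengths `a₁`, `a₂`, `a₃`,
`a₄`), the pairs `a b` and `c d` are at opposite corners; the rectangle is drawn with its sides in
the directions of slope `1` and `-1`. -/
lemma exists_plane_embedding_of_le {X : Type*} [PseudoMetricSpace X] (a b c d : X)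
    (h₁ : dist a c + dist b d ≤ dist a b + dist c d)
    (h₂ : dist a d + dist b c ≤ dist a b + dist c d) :
    ∃ A B C D : ℝ × ℝ, dist A B = dist a b ∧ dist A C = dist a c ∧ dist A D = dist a d ∧
      dist B C = dist b c ∧ dist B D = dist b d ∧ dist C D = dist c d := by
  obtain ⟨a₁, e1⟩ : ∃ t, 2 * t = dist a c + dist a d - dist c d := ⟨_, mul_div_cancel₀ _ two_ne_zero⟩
  obtain ⟨a₂, e2⟩ : ∃ t, 2 * t = dist b c + dist b d - dist c d := ⟨_, mul_div_cancel₀ _ two_ne_zero⟩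
  obtain ⟨a₃, e3⟩ : ∃ t, 2 * t = dist a c + dist b c - dist a b := ⟨_, mul_div_cancel₀ _ two_ne_zero⟩
  obtain ⟨a₄, e4⟩ : ∃ t, 2 * t = dist a d + dist b d - dist a b := ⟨_, mul_div_cancel₀ _ two_ne_zero⟩
  obtain ⟨h, e5⟩ : ∃ t, 2 * t = dist a b + dist c d - (dist a d + dist b c) :=
    ⟨_, mul_div_cancel₀ _ two_ne_zero⟩
  obtain ⟨w, e6⟩ : ∃ t, 2 * t = dist a b + dist c d - (dist a c + dist b d) :=
    ⟨_, mul_div_cancel₀ _ two_ne_zero⟩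
  have t1 : dist c d ≤ dist a c + dist a d := dist_triangle_left c d a
  have t2 : dist c d ≤ dist b c + dist b d := dist_triangle_left c d b
  have t3 : dist a b ≤ dist a c + dist b c := dist_triangle_right a b c
  have t4 : dist a b ≤ dist a d + dist b d := dist_triangle_right a b d
  refine ⟨(-a₁, -a₁), (h + a₂ + w, h + a₂ - w), (h - a₃, h + a₃), (w + a₄, -w - a₄), ?_⟩
  refine ⟨dist_eq_of_fst ?_ ?_ ?_, dist_eq_of_snd ?_ ?_ ?_, dist_eq_of_fst ?_ ?_ ?_, ?_,
    ?_, ?_⟩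
  · linarith
  · linarith
  · linarith
  · linarith
  · linarith
  · linarith
  · linarith
  · linarith
  · linarith
  · rw [dist_comm]
    apply dist_eq_of_fst <;> linarith
  · rw [dist_comm]
    apply dist_eq_of_snd <;> linarith
  · rw [dist_comm]
    apply dist_eq_of_snd <;> linarith

lemma exists_plane_embedding {X : Type*} [PseudoMetricSpace X] (r : Fin 4 → X) :
    ∃ q : Fin 4 → ℝ × ℝ, ∀ i j, dist (q i) (q j) = dist (r i) (r j) := by
  suffices h : ∃ A B C D : ℝ × ℝ, dist A B = dist (r 0) (r 1) ∧ dist A C = dist (r 0) (r 2) ∧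
      dist A D = dist (r 0) (r 3) ∧ dist B C = dist (r 1) (r 2) ∧ dist B D = dist (r 1) (r 3) ∧
      dist C D = dist (r 2) (r 3) by
    obtain ⟨A, B, C, D, h01, h02, h03, h12, h13, h23⟩ := h
    refine ⟨![A, B, C, D], fun i j => ?_⟩
    fin_cases i <;> fin_cases j <;> first
      | exact (dist_self _).trans (dist_self _).symm
      | assumption
      | (rw [dist_comm, dist_comm (r _)]; assumption)
  rcases le_total (dist (r 0) (r 2) + dist (r 1) (r 3)) (dist (r 0) (r 1) + dist (r 2) (r 3))
    with h1 | h1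
  · rcases le_total (dist (r 0) (r 3) + dist (r 1) (r 2)) (dist (r 0) (r 1) + dist (r 2) (r 3))
      with h2 | h2
    · exact exists_plane_embedding_of_le _ _ _ _ h1 h2
    · obtain ⟨A, D, B, C, h03, h01, h02, h13, h23, h12⟩ := exists_plane_embedding_of_le
        (r 0) (r 3) (r 1) (r 2) (by rw [dist_comm (r 3) (r 2)]; linarith)
        (by rw [dist_comm (r 3) (r 1)]; linarith)
      rw [dist_comm, dist_comm (r 3)] at h13 h23
      exact ⟨A, B, C, D, h01, h02, h03, h12, h13, h23⟩
  · rcases le_total (dist (r 0) (r 3) + dist (r 1) (r 2)) (dist (r 0) (r 2) + dist (r 1) (r 3))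
      with h2 | h2
    · obtain ⟨A, C, B, D, h02, h01, h03, h12, h23, h13⟩ := exists_plane_embedding_of_le
        (r 0) (r 2) (r 1) (r 3) (by linarith)
        (by rw [dist_comm (r 2) (r 1)]; linarith)
      rw [dist_comm, dist_comm (r 2)] at h12
      exact ⟨A, B, C, D, h01, h02, h03, h12, h13, h23⟩
    · obtain ⟨A, D, B, C, h03, h01, h02, h13, h23, h12⟩ := exists_plane_embedding_of_le
        (r 0) (r 3) (r 1) (r 2) (by rw [dist_comm (r 3) (r 2)]; linarith)
        (by rw [dist_comm (r 3) (r 1)]; linarith)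
      rw [dist_comm, dist_comm (r 3)] at h13 h23
      exact ⟨A, B, C, D, h01, h02, h03, h12, h13, h23⟩

/-- In a normed space of dimension at least two, spheres are connected, so that two spheres meet
unless one of the triangle inequalities forbids it. -/
lemma exists_dist_eq_dist_eq {E : Type*} [NormedAddCommGroup E] [NormedSpace ℝ E]
    (hE : 1 < Module.rank ℝ E) (p q : E) {s t : ℝ} (hs : 0 ≤ s)
    (h₁ : dist p q ≤ s + t) (h₂ : s ≤ dist p q + t) (h₃ : t ≤ dist p q + s) :
    ∃ z, dist z p = s ∧ dist z q = t := by
  have : Nontrivial E := rank_pos_iff_nontrivial.1 (zero_lt_one.trans hE)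
  by_cases hpq : p = q
  · subst hpq
    rw [dist_self] at h₂ h₃
    obtain ⟨z, hz⟩ := (NormedSpace.sphere_nonempty (x := p)).2 hs
    exact ⟨z, hz, (show dist z p = s from hz).trans (by linarith)⟩
  · have hc : 0 < dist p q := dist_pos.2 hpq
    have hc' : dist p q = ‖q - p‖ := by rw [dist_comm, dist_eq_norm]
    have hon : ∀ e : ℝ, |e| = 1 → p + (e * (s / dist p q)) • (q - p) ∈ Metric.sphere p s := by
      intro e he
      rw [mem_sphere_iff_norm, add_sub_cancel_left, norm_smul, ← hc', Real.norm_eq_abs, abs_mul, he,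
        one_mul, abs_of_nonneg (div_nonneg hs hc.le), div_mul_cancel₀ _ hc.ne']
    have hval : ∀ e : ℝ, dist (p + (e * (s / dist p q)) • (q - p)) q = |dist p q - e * s| := by
      intro e
      have : p + (e * (s / dist p q)) • (q - p) - q = (e * (s / dist p q) - 1) • (q - p) := by
        rw [sub_smul, one_smul]
        abel
      rw [dist_eq_norm, this, norm_smul, ← hc', Real.norm_eq_abs]
      nth_rewrite 2 [← abs_of_pos hc]
      rw [← abs_mul, ← abs_neg]
      congr 1
      field_simp
      ring
    obtain ⟨z, hz, hzt⟩ := (isPreconnected_sphere hE p s).intermediate_value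
      (hon 1 (by simp)) (hon (-1) (by simp)) (f := fun z => dist z q) (by fun_prop)
      (show t ∈ _ from ⟨by
        rw [hval, abs_le]
        constructor <;> linarith, by
        rw [hval]
        exact le_trans (by linarith) (le_abs_self _)⟩)
    exact ⟨z, hz, hzt⟩

lemma one_lt_rank_real_prod : 1 < Module.rank ℝ (ℝ × ℝ) := by
  rw [rank_prod', CommSemiring.rank_self, one_add_one_eq_two]
  exact Nat.one_lt_ofNat

variable {V : Type*} {G : SimpleGraph V}

lemma planeRealizable_of_card_le_four [Finite V] (h : Nat.card V ≤ 4) : PlaneRealizable G := by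
  intro X _ r
  rcases isEmpty_or_nonempty V with hV | hV
  · exact ⟨fun v => isEmptyElim v, fun v => isEmptyElim v⟩
  · have e : V ≃ Fin (Nat.card V) := Finite.equivFin V
    have hinj : Function.Injective (fun v => Fin.castLE h (e v)) :=
      (Fin.castLE_injective h).comp e.injective
    obtain ⟨q, hq⟩ := exists_plane_embedding
      (fun i => r (Function.invFun (fun v => Fin.castLE h (e v)) i))
    refine ⟨fun v => q (Fin.castLE h (e v)), fun v w _ => ?_⟩
    rw [hq]
    exact congrArg₂ (fun v w => dist (r v) (r w)) (Function.leftInverse_invFun hinj v)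
      (Function.leftInverse_invFun hinj w)

/-- Two realizations that share one vertex fit together after a translation. -/
lemma planeRealizable_of_closed {A : Set V} {z : V} (hz : z ∉ A)
    (hcl : ∀ a ∈ A, ∀ b, G.Adj a b → b ∈ A ∨ b = z)
    (h₁ : PlaneRealizable (G.induce (insert z A))) (h₂ : PlaneRealizable (G.induce Aᶜ)) :
    PlaneRealizable G := by
  classical
  intro X _ r
  obtain ⟨q₁, hq₁⟩ := h₁ X (fun v => r v)
  obtain ⟨q₂, hq₂⟩ := h₂ X (fun v => r v)
  obtain ⟨q, hqA, hqA'⟩ : ∃ q : V → ℝ × ℝ,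
      (∀ v (hv : v ∈ insert z A),
        q v = q₁ ⟨v, hv⟩ + (q₂ ⟨z, hz⟩ - q₁ ⟨z, Set.mem_insert z A⟩)) ∧
      ∀ v (hv : v ∈ Aᶜ), q v = q₂ ⟨v, hv⟩ := by
    refine ⟨fun v => if hv : v ∈ A then q₁ ⟨v, Set.mem_insert_of_mem z hv⟩ +
      (q₂ ⟨z, hz⟩ - q₁ ⟨z, Set.mem_insert z A⟩) else q₂ ⟨v, hv⟩, ?_, fun v hv => dif_neg hv⟩
    intro v hv
    by_cases hvA : v ∈ A
    · exact dif_pos hvA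
    · obtain rfl : v = z := hv.resolve_right hvA
      rw [add_sub_cancel]
      exact dif_neg hvA
  have hA : ∀ v ∈ A, ∀ w, G.Adj v w → dist (q v) (q w) = dist (r v) (r w) := by
    intro v hv w hvw
    have hw : w ∈ insert z A := (hcl v hv w hvw).symm
    rw [hqA v (.inr hv), hqA w hw, dist_add_right]
    exact hq₁ ⟨v, .inr hv⟩ ⟨w, hw⟩ hvw
  refine ⟨q, fun v w hvw => ?_⟩
  by_cases hv : v ∈ A
  · exact hA v hv w hvw
  · by_cases hw : w ∈ A
    · rw [dist_comm, dist_comm (r v)]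
      exact hA w hw v hvw.symm
    · rw [hqA' v hv, hqA' w hw]
      exact hq₂ ⟨v, hv⟩ ⟨w, hw⟩ hvw

/-- A vertex with two neighbours can be put back, as the spheres around the two intersect. -/
lemma planeRealizable_of_torso {v x y : V} (hxy : x ≠ y) (hvx : G.Adj v x) (hvy : G.Adj v y)
    (hv : ∀ c, G.Adj v c → c = x ∨ c = y) (h : PlaneRealizable (torso G {v}ᶜ x y)) :
    PlaneRealizable G := by
  classical
  intro X _ r
  obtain ⟨q, hq⟩ := h X (fun w => r w)
  have hxy' := hq ⟨x, hvx.ne'⟩ ⟨y, hvy.ne'⟩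
    ⟨fun e => hxy (congrArg Subtype.val e), .inr (.inl ⟨rfl, rfl⟩)⟩
  obtain ⟨z, hzx, hzy⟩ := exists_dist_eq_dist_eq one_lt_rank_real_prod
    (q ⟨x, hvx.ne'⟩) (q ⟨y, hvy.ne'⟩) (dist_nonneg (x := r v) (y := r x))
    (t := dist (r v) (r y)) (hxy' ▸ dist_triangle_left _ _ _)
    (by
      rw [hxy']
      have := dist_triangle_right (r v) (r x) (r y)
      linarith)
    (by
      rw [hxy']
      have := dist_triangle (r v) (r x) (r y)
      linarith)
  have hz : ∀ c (hc : c ≠ v), G.Adj v c → dist z (q ⟨c, hc⟩) = dist (r v) (r c) := by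
    intro c hc hvc
    rcases hv c hvc with rfl | rfl
    · exact hzx
    · exact hzy
  obtain ⟨q', hq'v, hq'⟩ : ∃ q' : V → ℝ × ℝ, q' v = z ∧ ∀ w (hw : w ∈ ({v}ᶜ : Set V)),
      q' w = q ⟨w, hw⟩ :=
    ⟨fun w => if hw : w ∈ ({v}ᶜ : Set V) then q ⟨w, hw⟩ else z, dif_neg (by simp),
      fun w hw => dif_pos hw⟩
  refine ⟨q', fun s t hst => ?_⟩
  by_cases hs : s = v
  · subst hs
    rw [hq'v, hq' t hst.ne']
    exact hz t hst.ne' hst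
  · by_cases ht : t = v
    · subst ht
      rw [hq'v, hq' s hst.ne, dist_comm, dist_comm (r s)]
      exact hz s hst.ne hst.symm
    · rw [hq' s hs, hq' t ht]
      exact hq ⟨s, hs⟩ ⟨t, ht⟩ ⟨fun e => hst.ne (congrArg Subtype.val e), .inl hst⟩

lemma hasMinorModel_induce (G : SimpleGraph V) (s : Set V) : HasMinorModel (G.induce s) G :=
  .of_injective_hom (SimpleGraph.Embedding.induce (G := G) s).toHom Subtype.val_injective

lemma card_coe_lt_of_notMem [Finite V] {s : Set V} {v : V} (hv : v ∉ s) :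
    Nat.card s < Nat.card V := by
  rw [Nat.card_coe_set_eq, ← Set.ncard_univ]
  exact Set.ncard_lt_ncard ⟨Set.subset_univ s, fun h => hv (h trivial)⟩

/-- Induction on the number of vertices: cut vertices are handled by gluing, vertices of degree two
by replacing them by an edge, and `TwoConn.hasMinorModel_wheelFour_or_kFourPlusKFour` leaves only
graphs on at most four vertices. -/
theorem planeRealizable_of_not_hasMinorModel {V : Type u} [Finite V]
    {G : SimpleGraph V} (hW : ¬ HasMinorModel wheelFour G)
    (hK : ¬ HasMinorModel kFourPlusKFour G) : PlaneRealizable G := by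
  induction hn : Nat.card V using Nat.strong_induction_on generalizing V with
  | _ n ih =>
  subst hn
  have step : ∀ {W : Type u} [Finite W] {H : SimpleGraph W}, HasMinorModel H G →
      Nat.card W < Nat.card V → PlaneRealizable H := fun hHG hlt =>
    ih _ hlt (fun h => hW (h.trans hHG)) (fun h => hK (h.trans hHG)) rfl
  by_cases h4 : Nat.card V ≤ 4
  · exact planeRealizable_of_card_le_four h4
  have h5 : 5 ≤ Nat.card V := by omega
  by_cases hG : TwoConn G
  · by_cases hd : MinDegThree G
    · exact ((hG.hasMinorModel_wheelFour_or_kFourPlusKFour rfl h5 hd).elim hW hK).elim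
    · unfold MinDegThree at hd
      push Not at hd
      obtain ⟨v, a, b, hab⟩ := hd
      have : Nontrivial V := Finite.one_lt_card_iff_nontrivial.1 (by omega)
      obtain ⟨t, htv⟩ := exists_ne v
      -- No vertex other than `v` contains the whole neighbourhood of `v`.
      have hnb : ∀ z, z ≠ v → ∃ c, G.Adj v c ∧ c ≠ z := by
        intro z hz
        by_contra! hc
        have := hG {v} z ⟨v, rfl⟩ hz (by
          rintro a rfl b hab
          exact .inr (hc b hab))
        have hcard : (Set.univ : Set V) ⊆ {v, z} := fun w _ => this w
        have := (Set.ncard_le_ncard hcard).trans (Set.ncard_insert_le v {z})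
        rw [Set.ncard_univ, Set.ncard_singleton] at this
        omega
      obtain ⟨x, hvx, -⟩ := hnb t htv
      obtain ⟨y, hvy, hyx⟩ := hnb x hvx.ne'
      have hv : ∀ c, G.Adj v c → c = x ∨ c = y := by
        intro c hc
        have h (t) (ht : G.Adj v t) : t = a ∨ t = b := or_iff_not_imp_left.2 (hab t ht)
        have h1 := h c hc; have h2 := h x hvx; have h3 := h y hvy
        grind
      refine planeRealizable_of_torso hyx.symm hvx hvy hv (step (hasMinorModel_torso
        (D := {v, x}) hvx.ne' (.inr rfl) (SimpleGraph.induce_pair_connected_of_adj hvx) ?_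
        ⟨v, .inl rfl, hvy⟩) (card_coe_lt_of_notMem (v := v) (by simp)))
      rintro w (rfl | rfl) hw
      · exact absurd rfl hw
      · rfl
  · unfold TwoConn at hG
    push Not at hG
    obtain ⟨A, z, ⟨a, ha⟩, hz, hcl, w, hwA, hwz⟩ := hG
    refine planeRealizable_of_closed hz hcl (step (hasMinorModel_induce G _)
      (card_coe_lt_of_notMem (v := w) ?_)) (step (hasMinorModel_induce G _)
      (card_coe_lt_of_notMem (v := a) (by simpa using ha)))
    rintro (h | h)
    · exact hwz h
    · exact hwA h

end Plane

/-! ### Two families of distances that are not realizable in the plane -/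

section Obstructions

/-- The ways in which the distance of two points of the plane can be attained: by one of the two
coordinates, with one of two signs. -/
lemma dist_plane_cases {p q : ℝ × ℝ} {d : ℝ} (h : dist p q = d) :
    (p.1 - q.1 ≤ d ∧ q.1 - p.1 ≤ d ∧ p.2 - q.2 ≤ d ∧ q.2 - p.2 ≤ d) ∧
      (p.1 - q.1 = d ∨ q.1 - p.1 = d ∨ p.2 - q.2 = d ∨ q.2 - p.2 = d) := by
  rw [Prod.dist_eq, Real.dist_eq, Real.dist_eq] at h
  have h₁ := abs_le.1 (h ▸ le_max_left |p.1 - q.1| |p.2 - q.2|)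
  have h₂ := abs_le.1 (h ▸ le_max_right |p.1 - q.1| |p.2 - q.2|)
  refine ⟨⟨h₁.2, by linarith, h₂.2, by linarith⟩, ?_⟩
  rcases max_choice |p.1 - q.1| |p.2 - q.2| with e | e <;> rw [e] at h
  · rcases abs_choice (p.1 - q.1) with e | e <;> rw [e] at h
    · exact .inl h
    · exact .inr (.inl (by linarith))
  · rcases abs_choice (p.2 - q.2) with e | e <;> rw [e] at h
    · exact .inr (.inr (.inl h))
    · exact .inr (.inr (.inr (by linarith)))

/-- After applying a symmetry of the square, a given distance is attained by the difference of the
first coordinates, with positive sign. -/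
lemma exists_dist_eq_fst_sub {V : Type*} (q : V → ℝ × ℝ) (a b : V) :
    ∃ q' : V → ℝ × ℝ, (∀ v w, dist (q' v) (q' w) = dist (q v) (q w)) ∧
      (q' a).1 - (q' b).1 = dist (q a) (q b) := by
  rcases (dist_plane_cases (rfl : dist (q a) (q b) = _)).2 with h | h | h | h
  · exact ⟨q, fun _ _ => rfl, h⟩
  · refine ⟨fun v => (-(q v).1, (q v).2), fun v w => ?_, by dsimp only; linarith⟩
    rw [Prod.dist_eq, Prod.dist_eq, dist_neg_neg]
  · refine ⟨fun v => (q v).swap, fun v w => ?_, h⟩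
    rw [Prod.dist_eq, Prod.dist_eq, max_comm]
    rfl
  · refine ⟨fun v => (-(q v).2, (q v).1), fun v w => ?_, by dsimp only; linarith⟩
    rw [Prod.dist_eq, Prod.dist_eq, dist_neg_neg, max_comm]

/-- The distances of points `0, …, 3` on the rim and `4` at the hub are not attained in the plane:
case analysis on the coordinate and the sign with which each distance is attained. -/
lemma not_plane_wheelFour (q : Fin 5 → ℝ × ℝ) (h01 : dist (q 0) (q 1) = 6)
    (h12 : dist (q 1) (q 2) = 6) (h23 : dist (q 2) (q 3) = 6) (h30 : dist (q 3) (q 0) = 8)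
    (h40 : dist (q 4) (q 0) = 6) (h41 : dist (q 4) (q 1) = 8) (h42 : dist (q 4) (q 2) = 8)
    (h43 : dist (q 4) (q 3) = 6) : False := by
  obtain ⟨q', hq', h⟩ := exists_dist_eq_fst_sub q 0 1
  rw [h01] at h
  rw [← hq'] at h01 h12 h23 h30 h40 h41 h42 h43
  obtain ⟨⟨a1, a2, a3, a4⟩, -⟩ := dist_plane_cases h01
  obtain ⟨⟨b1, b2, b3, b4⟩, h12⟩ := dist_plane_cases h12
  obtain ⟨⟨c1, c2, c3, c4⟩, h23⟩ := dist_plane_cases h23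
  obtain ⟨⟨d1, d2, d3, d4⟩, h30⟩ := dist_plane_cases h30
  obtain ⟨⟨e1, e2, e3, e4⟩, h40⟩ := dist_plane_cases h40
  obtain ⟨⟨f1, f2, f3, f4⟩, h41⟩ := dist_plane_cases h41
  obtain ⟨⟨g1, g2, g3, g4⟩, h42⟩ := dist_plane_cases h42
  obtain ⟨⟨i1, i2, i3, i4⟩, h43⟩ := dist_plane_cases h43
  generalize (q' 0).1 = x0 at *
  generalize (q' 1).1 = x1 at *
  generalize (q' 2).1 = x2 at *
  generalize (q' 3).1 = x3 at *
  generalize (q' 4).1 = x4 at *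
  generalize (q' 0).2 = y0 at *
  generalize (q' 1).2 = y1 at *
  generalize (q' 2).2 = y2 at *
  generalize (q' 3).2 = y3 at *
  generalize (q' 4).2 = y4 at *
  clear h01 hq'
  rcases h30 with h30 | h30 | h30 | h30 <;> try (exfalso; linarith)
  all_goals rcases h41 with h41 | h41 | h41 | h41 <;> try (exfalso; linarith)
  all_goals rcases h40 with h40 | h40 | h40 | h40 <;> try (exfalso; linarith)
  all_goals rcases h42 with h42 | h42 | h42 | h42 <;> try (exfalso; linarith)
  all_goals rcases h12 with h12 | h12 | h12 | h12 <;> try (exfalso; linarith)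
  all_goals rcases h23 with h23 | h23 | h23 | h23 <;> try (exfalso; linarith)
  all_goals rcases h43 with h43 | h43 | h43 | h43 <;> linarith

/-- The points `4` and `5` are at distance `1` from both `0` and `1`, so `0` and `1` are at distance
at most `2`. If the distances `02` and `13` were attained by the same coordinate, then the equalities
`3 = 1 + 2` would put `0` and `1` at distance `4`. So different coordinates attain them, and then `0`
and `1` differ by `2` in both coordinates. Hence `4` and `5` both lie at the midpoint of `0` and `1`,
although their distance is `2`. -/
lemma not_plane_kFourPlusKFour (q : Fin 6 → ℝ × ℝ) (h02 : dist (q 0) (q 2) = 3)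
    (h03 : dist (q 0) (q 3) = 1) (h12 : dist (q 1) (q 2) = 1) (h13 : dist (q 1) (q 3) = 3)
    (h23 : dist (q 2) (q 3) = 2) (h04 : dist (q 0) (q 4) = 1) (h05 : dist (q 0) (q 5) = 1)
    (h14 : dist (q 1) (q 4) = 1) (h15 : dist (q 1) (q 5) = 1) (h45 : dist (q 4) (q 5) = 2) :
    False := by
  obtain ⟨q', hq', h⟩ := exists_dist_eq_fst_sub q 0 2
  rw [h02] at h
  rw [← hq'] at h02 h03 h12 h13 h23 h04 h05 h14 h15 h45
  obtain ⟨⟨a1, a2, a3, a4⟩, -⟩ := dist_plane_cases h02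
  obtain ⟨⟨b1, b2, b3, b4⟩, -⟩ := dist_plane_cases h03
  obtain ⟨⟨c1, c2, c3, c4⟩, -⟩ := dist_plane_cases h12
  obtain ⟨⟨d1, d2, d3, d4⟩, h13⟩ := dist_plane_cases h13
  obtain ⟨⟨e1, e2, e3, e4⟩, -⟩ := dist_plane_cases h23
  obtain ⟨⟨f1, f2, f3, f4⟩, -⟩ := dist_plane_cases h04
  obtain ⟨⟨g1, g2, g3, g4⟩, -⟩ := dist_plane_cases h05
  obtain ⟨⟨i1, i2, i3, i4⟩, -⟩ := dist_plane_cases h14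
  obtain ⟨⟨j1, j2, j3, j4⟩, -⟩ := dist_plane_cases h15
  obtain ⟨⟨k1, k2, k3, k4⟩, h45⟩ := dist_plane_cases h45
  generalize (q' 0).1 = x0 at *
  generalize (q' 1).1 = x1 at *
  generalize (q' 2).1 = x2 at *
  generalize (q' 3).1 = x3 at *
  generalize (q' 4).1 = x4 at *
  generalize (q' 5).1 = x5 at *
  generalize (q' 0).2 = y0 at *
  generalize (q' 1).2 = y1 at *
  generalize (q' 2).2 = y2 at *
  generalize (q' 3).2 = y3 at *
  generalize (q' 4).2 = y4 at *
  generalize (q' 5).2 = y5 at *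
  rcases h13 with h13 | h13 | h13 | h13 <;> try (exfalso; linarith)
  all_goals rcases h45 with h45 | h45 | h45 | h45 <;> linarith

end Obstructions

/-! ### The norms of `ℓ_1^2` and `ℓ_∞^2`, and the parameter `f_p` -/

section Norms

variable {V : Type*} {G : SimpleGraph V}

lemma norm_piLp_top_fin_two (x : PiLp ∞ (fun _ : Fin 2 => ℝ)) : ‖x‖ = max |x 0| |x 1| := by
  rw [← PiLp.norm_ofLp, Pi.norm_def]
  simp [Fin.univ_succ, ← Real.norm_eq_abs]

lemma norm_piLp_one_fin_two (x : PiLp 1 (fun _ : Fin 2 => ℝ)) : ‖x‖ = |x 0| + |x 1| := by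
  rw [PiLp.norm_eq_of_L1, Fin.sum_univ_two, Real.norm_eq_abs, Real.norm_eq_abs]

/-- The rotation behind the isometry between `ℓ_1^2` and `ℓ_∞^2`. -/
lemma max_abs_add_abs_sub (s t : ℝ) : max |s + t| |s - t| = |s| + |t| := by
  refine le_antisymm (max_le (abs_add_le s t) (abs_sub s t)) ?_
  rcases abs_choice s with hs | hs <;> rcases abs_choice t with ht | ht <;> rw [hs, ht]
  · exact le_max_of_le_left (le_abs_self _)
  · exact le_max_of_le_right ((sub_eq_add_neg s t) ▸ le_abs_self _)
  · exact le_max_of_le_right (by linarith [neg_abs_le (s - t)])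
  · exact le_max_of_le_left (by linarith [neg_abs_le (s + t)])

lemma PlaneRealizable.realizableIn_top (h : PlaneRealizable G) : RealizableIn ∞ G 2 := by
  intro m r
  obtain ⟨q, hq⟩ := h _ r
  refine ⟨fun v => WithLp.toLp ∞ ![(q v).1, (q v).2], fun v w hvw => ?_⟩
  rw [← dist_eq_norm, ← hq v w hvw, norm_piLp_top_fin_two, Prod.dist_eq]
  rfl

lemma RealizableIn.one_of_top [Finite V] (h : RealizableIn ∞ G 2) : RealizableIn 1 G 2 := by
  have := Fintype.ofFinite V
  intro m r
  have e : V ≃ Fin (Fintype.card V) := Fintype.equivFin V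
  -- The distances to the given points embed them isometrically into a space `ℓ_∞^n`.
  obtain ⟨q, hq⟩ := h (Fintype.card V) (fun v => WithLp.toLp ∞ fun i => dist (r v) (r (e.symm i)))
  refine ⟨fun v => WithLp.toLp 1 ![(q v 0 + q v 1) / 2, (q v 0 - q v 1) / 2], fun v w hvw => ?_⟩
  have h₁ : ‖(WithLp.toLp ∞ (fun i => dist (r v) (r (e.symm i))) -
      WithLp.toLp ∞ (fun i => dist (r w) (r (e.symm i))) :
        PiLp ∞ (fun _ : Fin (Fintype.card V) => ℝ))‖ = ‖r v - r w‖ := by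
    rw [← WithLp.toLp_sub, PiLp.norm_toLp, ← dist_eq_norm (r v)]
    refine le_antisymm ((pi_norm_le_iff_of_nonneg dist_nonneg).2 fun i => ?_) ?_
    · exact abs_dist_sub_le _ _ _
    · refine le_trans ?_ (norm_le_pi_norm _ (e w))
      simp
  rw [← h₁, hq v w hvw, norm_piLp_top_fin_two, norm_piLp_one_fin_two, ← max_abs_add_abs_sub]
  congr 2 <;>
  · simp
    ring

/-- A realization in `ℓ_1^2` may be viewed in the plane with the supremum norm. -/
lemma RealizableIn.exists_plane (h : RealizableIn 1 G 2) {m : ℕ}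
    (r : V → PiLp 1 (fun _ : Fin m => ℝ)) :
    ∃ q : V → ℝ × ℝ, ∀ v w, G.Adj v w → dist (q v) (q w) = ‖r v - r w‖ := by
  obtain ⟨q, hq⟩ := h m r
  refine ⟨fun v => (q v 0 + q v 1, q v 0 - q v 1), fun v w hvw => ?_⟩
  rw [hq v w hvw, norm_piLp_one_fin_two, ← max_abs_add_abs_sub, Prod.dist_eq, Real.dist_eq,
    Real.dist_eq]
  congr 2 <;>
  · simp
    ring

lemma RealizableIn.succ {p : ℝ≥0∞} [Fact (1 ≤ p)] {k : ℕ} (h : RealizableIn p G k) :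
    RealizableIn p G (k + 1) := by
  intro m r
  obtain ⟨q, hq⟩ := h m r
  have key : ∀ x : Fin k → ℝ, ‖(WithLp.toLp p (Fin.cons 0 x : Fin (k + 1) → ℝ) :
      PiLp p (fun _ : Fin (k + 1) => ℝ))‖ = ‖(WithLp.toLp p x : PiLp p (fun _ : Fin k => ℝ))‖ := by
    intro x
    by_cases hp : p = ∞
    · subst hp
      rw [PiLp.norm_toLp, PiLp.norm_toLp]
      refine le_antisymm ((pi_norm_le_iff_of_nonneg (norm_nonneg _)).2 fun i => ?_)
        ((pi_norm_le_iff_of_nonneg (norm_nonneg _)).2 fun i => ?_)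
      · refine Fin.cases ?_ (fun i => ?_) i
        · simp
        · exact norm_le_pi_norm x i
      · exact norm_le_pi_norm (Fin.cons 0 x : Fin (k + 1) → ℝ) i.succ
    · have hp' : 0 < p.toReal :=
        ENNReal.toReal_pos (zero_lt_one.trans_le (Fact.out : 1 ≤ p)).ne' hp
      rw [PiLp.norm_eq_sum hp', PiLp.norm_eq_sum hp', Fin.sum_univ_succ]
      simp [hp'.ne']
  refine ⟨fun v => WithLp.toLp p (Fin.cons 0 (q v)), fun v w hvw => ?_⟩
  have : (Fin.cons 0 (q v) - Fin.cons 0 (q w) : Fin (k + 1) → ℝ) = Fin.cons 0 ⇑(q v - q w) := by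
    ext i
    refine Fin.cases ?_ (fun i => ?_) i <;> simp
  have h₂ : (WithLp.toLp p (Fin.cons 0 (q v)) - WithLp.toLp p (Fin.cons 0 (q w)) :
      PiLp p (fun _ : Fin (k + 1) => ℝ)) = WithLp.toLp p (Fin.cons 0 ⇑(q v - q w)) := by
    rw [← WithLp.toLp_sub, this]
  dsimp only
  rw [h₂, key, hq v w hvw]

lemma fParam_le_iff {p : ℝ≥0∞} [Fact (1 ≤ p)] {k : ℕ} : fParam p G ≤ k ↔ RealizableIn p G k := by
  constructor
  · intro h
    obtain ⟨j, hj, hjk⟩ : ∃ j, RealizableIn p G j ∧ j ≤ k := by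
      by_contra! hc
      have : ((k + 1 : ℕ) : ℕ∞) ≤ fParam p G :=
        le_iInf₂ fun j hj => by exact_mod_cast hc j hj
      have := this.trans h
      norm_cast at this
      omega
    exact Nat.le_induction hj (fun _ _ h => h.succ) k hjk
  · intro h
    exact iInf₂_le k h

end Norms

/-! ### The two obstructions and the excluded minors -/

section Classification

lemma wheelFour_adj_iff (a b : Fin 5) :
    wheelFour.Adj a b ↔ a ≠ b ∧ (a = 4 ∨ b = 4 ∨ (a.val + b.val) % 2 = 1) := by
  rw [wheelFour, SimpleGraph.fromEdgeSet_adj]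
  fin_cases a <;> fin_cases b <;> simp

lemma kFourPlusKFour_adj_iff (a b : Fin 6) :
    kFourPlusKFour.Adj a b ↔
      a ≠ b ∧ (2 ≤ a ∨ 2 ≤ b) ∧ (a < 2 ∨ b < 2 ∨ (a < 4 ↔ b < 4)) := by
  rw [kFourPlusKFour, SimpleGraph.fromEdgeSet_adj]
  fin_cases a <;> fin_cases b <;> simp

instance : DecidableRel kFourPlusKFour.Adj :=
  fun a b => decidable_of_iff _ (kFourPlusKFour_adj_iff a b).symm

/-- The distances of these points are those of `not_plane_wheelFour`. -/
lemma not_realizableIn_wheelFour : ¬ RealizableIn 1 wheelFour 2 := by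
  intro h
  obtain ⟨q, hq⟩ := h.exists_plane (m := 4) (fun v => WithLp.toLp 1
    ((![![3, 0, 3, 0], ![4, 1, 1, 2], ![4, 2, 0, -2], ![2, 4, 0, 0], ![0, 0, 0, 0]] :
      Fin 5 → Fin 4 → ℝ) v))
  simp only [← WithLp.toLp_sub, PiLp.norm_eq_of_L1, wheelFour_adj_iff] at hq
  apply not_plane_wheelFour q <;> rw [hq _ _ (by decide)] <;> simp [Fin.sum_univ_succ] <;> norm_num

/-- The distances of these points are those of `not_plane_kFourPlusKFour`. -/
lemma not_realizableIn_kFourPlusKFour : ¬ RealizableIn 1 kFourPlusKFour 2 := by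
  intro h
  obtain ⟨q, hq⟩ := h.exists_plane (m := 3) (fun v => WithLp.toLp 1
    ((![![1, 1, 0], ![1, 0, 1], ![0, 0, 1], ![0, 1, 0], ![1, 1, 1], ![1, 0, 0]] :
      Fin 6 → Fin 3 → ℝ) v))
  simp only [← WithLp.toLp_sub, PiLp.norm_eq_of_L1, kFourPlusKFour_adj_iff] at hq
  apply not_plane_kFourPlusKFour q <;> rw [hq _ _ (by decide)] <;> simp [Fin.sum_univ_succ] <;>
    norm_num

lemma minDegThree_wheelFour : MinDegThree wheelFour := by
  unfold MinDegThree
  simp only [wheelFour_adj_iff]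
  decide

set_option synthInstance.maxSize 1000 in
set_option maxRecDepth 10000 in
/-- Deleting a vertex `z` of `K₄ +ₑ K₄` or contracting an edge `zt` leaves a vertex `v` of degree at
most two. The deletion is the case `t = z`. -/
lemma kFourPlusKFour_exists_degree_le_two : ∀ z t : Fin 6, t = z ∨ kFourPlusKFour.Adj z t →
    ∃ v p q, v ≠ z ∧ ∀ w, w ≠ z → w ≠ v → (kFourPlusKFour.Adj v w ∨
      (t = v ∧ kFourPlusKFour.Adj z w) ∨ (t = w ∧ kFourPlusKFour.Adj z v)) → w = p ∨ w = q := by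
  decide

/-- A model of `W₄` in `K₄ +ₑ K₄` leaves one spare vertex, which is deleted or contracted; both
create a vertex of degree two. -/
lemma not_hasMinorModel_wheelFour_kFourPlusKFour : ¬ HasMinorModel wheelFour kFourPlusKFour := by
  intro h
  obtain ⟨f, g, hg, hc, ha⟩ := h.exists_section
  have hinj : Function.Injective g := fun a b hab => Option.some_injective _ (by
    rw [← hg a, ← hg b, hab])
  obtain ⟨z, hz⟩ : ∃ z, ∀ v, v ≠ z → ∃ a, g a = v := by
    have hcard : (Finset.univ.image g)ᶜ.card = 1 := by
      rw [Finset.card_compl, Finset.card_image_of_injective _ hinj]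
      rfl
    obtain ⟨z, hz⟩ := Finset.card_eq_one.1 hcard
    refine ⟨z, fun v hv => ?_⟩
    have : v ∉ (Finset.univ.image g)ᶜ := by
      rw [hz]
      simpa using hv
    simpa using this
  have hfib : ∀ x a, f x = some a → x = g a ∨ x = z := by
    intro x a hx
    by_cases hxz : x = z
    · exact .inr hxz
    · obtain ⟨b, rfl⟩ := hz x hxz
      exact .inl (congrArg g (Option.some_injective _ ((hg b).symm.trans hx)))
  have hgz : ∀ a, g a ≠ z := by
    intro a haz
    have hs : Function.Surjective g := fun v => by
      by_cases hv : v = z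
      · exact ⟨a, haz.trans hv.symm⟩
      · exact hz v hv
    have := Fintype.card_le_of_surjective g hs
    simp at this
  obtain ⟨t, ht, htz⟩ : ∃ t, (t = z ∨ kFourPlusKFour.Adj z t) ∧ ∀ a, f z = some a → t = g a := by
    cases hfz : f z with
    | none => exact ⟨z, .inl rfl, fun a h => by simp at h⟩
    | some a =>
      refine ⟨g a, .inr ?_, fun b hb => congrArg g (Option.some_injective _ hb)⟩
      obtain ⟨w⟩ := (hc a).preconnected ⟨z, hfz⟩ ⟨g a, hg a⟩
      cases hw : w with
      | nil => exact absurd rfl (hgz a)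
      | @cons _ y _ hzy _ =>
        have hzy' : kFourPlusKFour.Adj z y.1 := hzy
        rcases hfib y.1 a y.2 with h1 | h1
        · exact h1 ▸ hzy'
        · exact absurd h1 hzy'.ne'
  obtain ⟨v, p, q, hvz, hv⟩ := kFourPlusKFour_exists_degree_le_two z t ht
  obtain ⟨a, rfl⟩ := hz v hvz
  obtain ⟨b, hab, hbp, hbq⟩ := minDegThree_wheelFour a ((f p).getD 0) ((f q).getD 0)
  have hne : ∀ p, b ≠ (f p).getD 0 → g b ≠ p := by
    rintro _ h rfl
    rw [hg] at h
    exact h rfl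
  refine (hv (g b) (hgz b) (fun h => hab.ne' (hinj h)) ?_).elim (hne p hbp) (hne q hbq)
  obtain ⟨x, y, hx, hy, hxy⟩ := ha a b hab
  rcases hfib x a hx with rfl | rfl
  · rcases hfib y b hy with rfl | rfl
    · exact .inl hxy
    · exact .inr (.inr ⟨htz b hy, hxy.symm⟩)
  · rcases hfib y b hy with rfl | rfl
    · exact .inr (.inl ⟨htz a hx, hxy⟩)
    · exact absurd rfl hxy.ne

variable {V : Type u} {G : SimpleGraph V}

lemma realizableIn_one_two_iff [Finite V] :
    RealizableIn 1 G 2 ↔ ¬ HasMinorModel wheelFour G ∧ ¬ HasMinorModel kFourPlusKFour G :=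
  ⟨fun h => ⟨fun hW => not_realizableIn_wheelFour (h.of_hasMinorModel hW),
    fun hK => not_realizableIn_kFourPlusKFour (h.of_hasMinorModel hK)⟩,
    fun h => (planeRealizable_of_not_hasMinorModel h.1 h.2).realizableIn_top.one_of_top⟩

lemma realizableIn_one_iff_top [Finite V] : RealizableIn 1 G 2 ↔ RealizableIn ∞ G 2 :=
  ⟨fun h => (planeRealizable_of_not_hasMinorModel (realizableIn_one_two_iff.1 h).1
    (realizableIn_one_two_iff.1 h).2).realizableIn_top, fun h => h.one_of_top⟩

lemma isExcludedMinor_iff {p : ℝ≥0∞} [Fact (1 ≤ p)] {k : ℕ} :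
    IsExcludedMinor p k G ↔ ¬ RealizableIn p G k ∧
      ∀ (W : Type u) [Finite W] (H : SimpleGraph W),
        HasMinorModel H G → ¬ Nonempty (H ≃g G) → RealizableIn p H k := by
  rw [IsExcludedMinor, ← not_le, fParam_le_iff]
  simp only [fParam_le_iff]
  exact and_congr_right fun _ => ⟨fun h W _ H hH => h W H hH.isMinor,
    fun h W _ H hH => h W H hH.hasMinorModel⟩

/-- A graph that is not realizable occurs as a minor of an excluded minor only if it is isomorphic
to it. -/
lemma IsExcludedMinor.nonempty_iso {p : ℝ≥0∞} [Fact (1 ≤ p)] {k n : ℕ} {F : SimpleGraph (Fin n)}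
    (h : IsExcludedMinor p k G) (hF : ¬ RealizableIn p F k) (hFG : HasMinorModel F G) :
    Nonempty (G ≃g F) := by
  by_contra hno
  let e : F.comap (Equiv.ulift.{u} : ULift.{u} (Fin n) ≃ Fin n) ≃g F :=
    SimpleGraph.Iso.comap Equiv.ulift F
  refine hF (((isExcludedMinor_iff.1 h).2 _ _ ((HasMinorModel.of_iso e).trans hFG)
    ?_).of_hasMinorModel (.of_iso e.symm))
  rintro ⟨e'⟩
  exact hno ⟨e'.symm.trans e⟩

end Classification

theorem corollary1p4 {V : Type u} [Finite V] (G : SimpleGraph V) :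
    (IsExcludedMinor 1 2 G ↔ Nonempty (G ≃g wheelFour) ∨ Nonempty (G ≃g kFourPlusKFour)) ∧
    (fParam 1 G ≤ 2 ↔ fParam ∞ G ≤ 2) := by
  refine ⟨⟨fun h => ?_, ?_⟩, ?_⟩
  · have hG := (isExcludedMinor_iff.1 h).1
    rw [realizableIn_one_two_iff, not_and_or, not_not, not_not] at hG
    exact hG.imp (h.nonempty_iso not_realizableIn_wheelFour)
      (h.nonempty_iso not_realizableIn_kFourPlusKFour)
  · rintro (⟨⟨e⟩⟩ | ⟨⟨e⟩⟩) <;> refine isExcludedMinor_iff.2 ⟨fun h => ?_, fun W _ H hHG hno => ?_⟩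
    · exact not_realizableIn_wheelFour (h.of_hasMinorModel (.of_iso e.symm))
    · refine realizableIn_one_two_iff.2 ⟨fun hW => ?_, fun hK => ?_⟩
      · exact hno (hHG.antisymm ((HasMinorModel.of_iso e).trans hW))
      · have := (hK.trans (hHG.trans (.of_iso e))).card_le
        simp at this
    · exact not_realizableIn_kFourPlusKFour (h.of_hasMinorModel (.of_iso e.symm))
    · refine realizableIn_one_two_iff.2 ⟨fun hW => ?_, fun hK => ?_⟩
      · exact not_hasMinorModel_wheelFour_kFourPlusKFour (hW.trans (hHG.trans (.of_iso e)))
      · exact hno (hHG.antisymm ((HasMinorModel.of_iso e).trans hK))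
  · exact fParam_le_iff.trans (realizableIn_one_iff_top.trans fParam_le_iff.symm)
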